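/- **Setting.** Let $\dot A$ be a closed, densely defined, prime symmetric operator with equal finite deficiency indices in a Hilbert space $\mathcal H$ (prime: no non-zero reducing subspace on which it induces a self-adjoint operator). Let $\mathcal H_+=\mathrm{dom}(\dot A^*)$ with inner product $(f,g)_+=(f,g)+(\dot A^*f,\dot A^*g)$, and let $\mathcal H_+\subset\mathcal H\subset\mathcal H_-$ be the corresponding rigged Hilbert space, $\mathcal H_-$ being the (anti)dual of $\mathcal H_+$. A (minimal, scattering) *L-system* with input-output space $\mathbb C$ is $$\Theta=\begin{pmatrix}\mathbb A & K & 1\\ \mathcal H_+\subset\mathcal H\subset\mathcal H_- & & \mathbb C\end{pmatrix},$$ where * the main operator $T$ is non-symmetric with $\dot A\subset T\subset\dot A^*$, $\rho(T)\neq\emptyset$ and $\mathrm{dom}(\dot A)=\mathrm{dom}(T)\cap\mathrm{dom}(T^*)$; * $\mathbb A:\mathcal H_+\to\mathcal H_-$ is bounded, $\mathbb A\supset T$, $\mathbb A^*\supset T^*$, $\mathrm{Re}\,\mathbb A\supset\dot A$, and the quasi-kernel of $\mathrm{Re}\,\mathbb A$ (its restriction to $\{f\in\mathcal H_+:\mathrm{Re}\,\mathbb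 A f\in\mathcal H\}$) is self-adjoint in $\mathcal H$; * $K:\mathbb C\to\mathcal H_-$ is bounded, $\mathrm{Im}\,\mathbb A=KK^*$ and $\mathrm{ran}\,K=\mathrm{ran}\,\mathrm{Im}\,\mathbb A$. Its transfer and impedance functions are $$W_\Theta(z)=1-2iK^*(\mathbb A-zI)^{-1}K\quad(z\in\rho(T)),\qquad V_\Theta(z)=K^*(\mathrm{Re}\,\mathbb A-zI)^{-1}K\quad(z\in\mathbb C\setminus\mathbb R).$$ For $\alpha\in[0,\pi)$, an L-system $\Theta_\alpha$ of the same kind (possibly in another Hilbert space) is a *unimodular transformation* of $\Theta$ if $W_{\Theta_\alpha}(z)=W_\Theta(z)\cdot(-e^{2i\alpha})$ wherever both transfer functions are defined; it is *non-trivial* if $\alpha\neq\pi/2$. For $0\le\kappa<1$ and $Q\in\mathbb R$, the class $\mathfrak M^{-1,Q}_\kappa$ consists of the functions $V$ on the upper half-plane $\mathbb C_+$ of the form $$V(z)=Q+\int_{\mathbb R}\left(\frac1{\lambda-z}-\frac{\lambda}{1+\lambda^2}\right)d\mu(\lambda),$$ where $\mu$ is an infinite Borel measure on $\mathbb R$ with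 $\int_{\mathbb R}\frac{d\mu(\lambda)}{1+\lambda^2}=\frac{1+\kappa}{1-\kappa}$. A function defined on a larger set is said to belong to the class if its restriction to $\mathbb C_+$ does. **Theorem.** Let $0\le\kappa<1$, let $Q\neq0$ be real, and put $a=\frac{1+\kappa}{1-\kappa}$, $b=Q^2+a^2-1$. Let $\Theta$ be an L-system as above with $V_\Theta\in\mathfrak M^{-1,Q}_\kappa$, and let $\Theta_\alpha$, $\alpha\in[0,\pi)\setminus\{\pi/2\}$, be a non-trivial unimodular transformation of $\Theta$. Then $V_{\Theta_\alpha}\in\mathfrak M^{-1,-Q}_\kappa$ if and only if $$\tan\alpha=\frac{b}{2Q}.$$ -/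

import Mathlib

open MeasureTheory ComplexConjugate

noncomputable section

namespace LSys

variable {H : Type*} [NormedAddCommGroup H] [InnerProductSpace ℂ H] [CompleteSpace H]

/-! ### Unbounded operators

Unbounded operators are partially defined linear maps `H →ₗ.[ℂ] H`; `A.adjoint` is the Hilbert
space adjoint of a densely defined operator, and `A ≤ B` means that `B` extends `A`. -/

/-- Closed, densely defined, symmetric operators. -/
structure IsClosedSymmetric (A : H →ₗ.[ℂ] H) : Prop where
  dense : Dense (A.domain : Set H)
  closed : A.IsClosed
  symmetric : A ≤ A.adjoint

/-- The subspace `Ker (A - z I)` of an unbounded operator. -/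
def kerSub (A : H →ₗ.[ℂ] H) (z : ℂ) : Submodule ℂ H :=
  A.graph.comap (LinearMap.prod LinearMap.id (z • LinearMap.id))

/-- The deficiency subspaces `Ker (A* ∓ i I)` are finite-dimensional of the same dimension. -/
def HasEqualFiniteDeficiency (A : H →ₗ.[ℂ] H) : Prop :=
  FiniteDimensional ℂ (kerSub A.adjoint Complex.I) ∧
  FiniteDimensional ℂ (kerSub A.adjoint (-Complex.I)) ∧
  Module.finrank ℂ (kerSub A.adjoint Complex.I) = Module.finrank ℂ (kerSub A.adjoint (-Complex.I))

/-- The resolvent set: `T - z I` is a bijection of `dom T` onto `H` with bounded inverse. -/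
def resolvent (T : H →ₗ.[ℂ] H) : Set ℂ :=
  {z | ∃ R : H →L[ℂ] H,
    (∀ h : H, ∃ hR : R h ∈ T.domain, T ⟨R h, hR⟩ - z • R h = h) ∧
    (∀ f : T.domain, R (T f - z • (f : H)) = f)}

/-- The closed subspace `S` reduces `A`: its orthogonal projection maps `dom A` into itself and
commutes with `A` there. -/
def Reduces (S : Submodule ℂ H) [CompleteSpace S] (A : H →ₗ.[ℂ] H) : Prop :=
  ∀ f : A.domain, ∃ hf : S.starProjection (f : H) ∈ A.domain,
    A ⟨S.starProjection (f : H), hf⟩ = S.starProjection (A f)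

/-- The operator induced by `A` in the subspace `S`, with domain
`{x ∈ S | x ∈ dom A, A x ∈ S}`. -/
def induced (A : H →ₗ.[ℂ] H) (S : Submodule ℂ H) : S →ₗ.[ℂ] S :=
  (A.graph.comap (LinearMap.prodMap S.subtype S.subtype)).toLinearPMap

/-- `A` is prime: no non-zero reducing subspace on which `A` induces a self-adjoint operator. -/
def IsPrime (A : H →ₗ.[ℂ] H) : Prop :=
  ∀ (S : Submodule ℂ H) [CompleteSpace S],
    Reduces S A → IsSelfAdjoint (induced A S) → S = ⊥

/-- Quasi-self-adjoint extensions `T` of `A`: non-symmetric operators with `A ⊂ T ⊂ A*`. -/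
structure IsQuasiSelfAdjointExt (A T : H →ₗ.[ℂ] H) : Prop where
  le : A ≤ T
  le_adjoint : T ≤ A.adjoint
  not_symmetric : ¬ T.IsFormalAdjoint T

/-- The class `Λ(A)`. -/
structure ClassLambda (A T : H →ₗ.[ℂ] H) : Prop extends IsQuasiSelfAdjointExt A T where
  resolvent_nonempty : (resolvent T).Nonempty
  domain_eq : A.domain = T.domain ⊓ T.adjoint.domain

/-! ### The rigged Hilbert space `H₊ ⊂ H ⊂ H₋` of a symmetric operator -/

/-- The inner product `(f, g) + (A* f, A* g)` on `dom A*` (linear in the second argument, as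
everywhere in Mathlib). -/
@[reducible] def plusCore (A : H →ₗ.[ℂ] H) : InnerProductSpace.Core ℂ A.adjoint.domain where
  inner f g := inner ℂ (f : H) (g : H) + inner ℂ (A.adjoint f) (A.adjoint g)
  conj_inner_symm f g := by simp
  re_inner_nonneg f := by
    simp only [map_add]
    exact add_nonneg inner_self_nonneg inner_self_nonneg
  add_left f g h := by
    simp only [Submodule.coe_add, LinearPMap.map_add, inner_add_left]; ring
  smul_left f g r := by
    simp only [Submodule.coe_smul, LinearPMap.map_smul, inner_smul_left]; ring
  definite f hf := by
    have h1 := congrArg Complex.re hf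
    have h2 : 0 ≤ (inner ℂ (A.adjoint f) (A.adjoint f)).re := inner_self_nonneg (𝕜 := ℂ)
    have h3 : (inner ℂ (f : H) (f : H)).re = ‖(f : H)‖ ^ 2 := inner_self_eq_norm_sq (𝕜 := ℂ) _
    simp only [Complex.add_re, Complex.zero_re] at h1
    have h4 : ‖(f : H)‖ ^ 2 = 0 := le_antisymm (by linarith) (sq_nonneg _)
    exact Subtype.ext (norm_eq_zero.mp ((pow_eq_zero_iff two_ne_zero).mp h4))

/-- `H₊`: the space `dom A*` with the inner product `(f, g)₊ = (f, g) + (A* f, A* g)` and its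
norm (not the norm of `H`). -/
def Hplus (A : H →ₗ.[ℂ] H) : Type _ := A.adjoint.domain

instance (A : H →ₗ.[ℂ] H) : NormedAddCommGroup (Hplus A) :=
  (plusCore A).toNormedAddCommGroup

instance (A : H →ₗ.[ℂ] H) : InnerProductSpace ℂ (Hplus A) :=
  InnerProductSpace.ofCore (plusCore A).toCore

/-- The inclusion of `H₊` in `H`. -/
def incl (A : H →ₗ.[ℂ] H) : Hplus A →ₗ[ℂ] H where
  toFun f := A.adjoint.domain.subtype f
  map_add' f g := A.adjoint.domain.subtype.map_add f g
  map_smul' c f := A.adjoint.domain.subtype.map_smul c f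

/-- The operator `A*` as a map from `H₊` to `H`. -/
def adjMap (A : H →ₗ.[ℂ] H) : Hplus A →ₗ[ℂ] H where
  toFun f := A.adjoint.toFun f
  map_add' f g := A.adjoint.toFun.map_add f g
  map_smul' c f := A.adjoint.toFun.map_smul c f

theorem inner_plus (A : H →ₗ.[ℂ] H) (f g : Hplus A) :
    inner ℂ f g = inner ℂ (incl A f) (incl A g) + inner ℂ (adjMap A f) (adjMap A g) := rfl

theorem norm_incl_le (A : H →ₗ.[ℂ] H) (f : Hplus A) : ‖incl A f‖ ≤ ‖f‖ := by
  have h1 : RCLike.re (inner ℂ f f) = ‖f‖ ^ 2 := inner_self_eq_norm_sq (𝕜 := ℂ) f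
  have h2 : RCLike.re (inner ℂ (incl A f) (incl A f)) = ‖incl A f‖ ^ 2 :=
    inner_self_eq_norm_sq (𝕜 := ℂ) _
  have h3 : 0 ≤ RCLike.re (inner ℂ (adjMap A f) (adjMap A f)) := inner_self_nonneg
  rw [inner_plus, map_add] at h1
  exact (sq_le_sq₀ (norm_nonneg _) (norm_nonneg _)).mp (by linarith)

/-- The bounded inclusion of `H₊` in `H`. -/
def inclL (A : H →ₗ.[ℂ] H) : Hplus A →L[ℂ] H :=
  (incl A).mkContinuous 1 (fun f => by simpa using norm_incl_le A f)

/-- `H₋`: the space dual to `H₊`, i.e. the bounded conjugate-linear functionals on `H₊` with the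
dual norm. The value of `φ ∈ H₋` at `f ∈ H₊` is the pairing `(φ, f)`. -/
abbrev Hminus (A : H →ₗ.[ℂ] H) : Type _ := Hplus A →L⋆[ℂ] ℂ

/-- The inclusion of `H` in `H₋`: the vector `h` acts by `f ↦ (h, f)`. -/
def toMinus (A : H →ₗ.[ℂ] H) : H →ₗ[ℂ] Hminus A where
  toFun h := (innerSLFlip ℂ h).comp (inclL A)
  map_add' h k := by ext f; simp
  map_smul' c h := by ext f; simp

theorem toMinus_apply (A : H →ₗ.[ℂ] H) (h : H) (f : Hplus A) :
    toMinus A h f = inner ℂ (incl A f) h := rfl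

/-! ### Bi-extensions -/

/-- The adjoint `𝔹* ∈ [H₊, H₋]` of `𝔹 ∈ [H₊, H₋]`: `(𝔹* g, f) = conj (𝔹 f, g)`. -/
def biAdj {A : H →ₗ.[ℂ] H} (B : Hplus A →L[ℂ] Hminus A) : Hplus A →L[ℂ] Hminus A :=
  LinearMap.mkContinuous₂
    (LinearMap.mk₂'ₛₗ (RingHom.id ℂ) (starRingEnd ℂ) (fun g f => conj (B f g))
      (by intros; simp) (by intros; simp) (by intros; simp) (by intros; simp))
    ‖B‖ (fun g f => by
      simp only [LinearMap.mk₂'ₛₗ_apply, RCLike.norm_conj]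
      calc ‖B f g‖ ≤ ‖B‖ * ‖f‖ * ‖g‖ := B.le_opNorm₂ f g
        _ = ‖B‖ * ‖g‖ * ‖f‖ := by ring)

theorem biAdj_apply {A : H →ₗ.[ℂ] H} (B : Hplus A →L[ℂ] Hminus A) (f g : Hplus A) :
    biAdj B g f = conj (B f g) := rfl

/-- `Re 𝔹 = (𝔹 + 𝔹*) / 2`. -/
def biRe {A : H →ₗ.[ℂ] H} (B : Hplus A →L[ℂ] Hminus A) : Hplus A →L[ℂ] Hminus A :=
  (1 / 2 : ℂ) • (B + biAdj B)

/-- `Im 𝔹 = (𝔹 - 𝔹*) / (2 i)`. -/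
def biIm {A : H →ₗ.[ℂ] H} (B : Hplus A →L[ℂ] Hminus A) : Hplus A →L[ℂ] Hminus A :=
  (1 / (2 * Complex.I)) • (B - biAdj B)

/-- The operator `𝔹 ∈ [H₊, H₋]` extends the operator `S` in `H` (so `dom S ⊂ H₊`). -/
def Extends {A : H →ₗ.[ℂ] H} (B : Hplus A →L[ℂ] Hminus A) (S : H →ₗ.[ℂ] H) : Prop :=
  ∀ f : S.domain, ∃ f' : Hplus A, incl A f' = f ∧ B f' = toMinus A (S f)

/-- The quasi-kernel of `𝔹`: the restriction of `𝔹` to `{f ∈ H₊ | 𝔹 f ∈ H}`, as an operator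
in `H`. Its graph consists of the pairs `(f, h)` with `f ∈ H₊`, `h ∈ H` and `𝔹 f = h`. -/
def quasiKernel {A : H →ₗ.[ℂ] H} (B : Hplus A →L[ℂ] Hminus A) : H →ₗ.[ℂ] H :=
  Submodule.toLinearPMap
    { carrier := {p : H × H | ∃ f : Hplus A, incl A f = p.1 ∧ B f = toMinus A p.2}
      zero_mem' := ⟨0, by simp, by simp⟩
      add_mem' := by
        rintro p q ⟨f, hf, hf'⟩ ⟨g, hg, hg'⟩
        exact ⟨f + g, by simp [hf, hg], by simp [hf', hg']⟩
      smul_mem' := by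
        rintro c p ⟨f, hf, hf'⟩
        exact ⟨c • f, by simp [hf], by simp [hf']⟩ }

/-- t-self-adjoint bi-extensions of `A`: self-adjoint bi-extensions with self-adjoint
quasi-kernel. -/
structure IsTSelfAdjointBiExt {A : H →ₗ.[ℂ] H} (B : Hplus A →L[ℂ] Hminus A) : Prop where
  self_adjoint : biAdj B = B
  extends_sym : Extends B A
  quasiKernel_self_adjoint : IsSelfAdjoint (quasiKernel B)

/-- `𝔸` is a (∗)-extension of the quasi-self-adjoint extension `T` of `A`: both `𝔸 ⊃ T` and
`𝔸* ⊃ T*`, and `Re 𝔸` is a t-self-adjoint bi-extension of `A`. -/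
structure IsStarExt {A : H →ₗ.[ℂ] H} (T : H →ₗ.[ℂ] H) (B : Hplus A →L[ℂ] Hminus A) : Prop where
  extends_op : Extends B T
  adj_extends : Extends (biAdj B) T.adjoint
  re_tSelfAdjoint : IsTSelfAdjointBiExt (biRe B)

/-- The adjoint `K* ∈ [H₊, ℂ]` of `K ∈ [ℂ, H₋]`: `(K* f, c) = (f, K c)`. -/
def channelAdj {A : H →ₗ.[ℂ] H} (K : ℂ →L[ℂ] Hminus A) : Hplus A →ₗ[ℂ] ℂ where
  toFun f := conj (K 1 f)
  map_add' f g := by simp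
  map_smul' c f := by simp

/-! ### L-systems -/

/-- Minimal scattering L-systems with input-output space `ℂ` (direction operator `J = 1`) in the
state space `H`. -/
structure LSystem (H : Type*) [NormedAddCommGroup H] [InnerProductSpace ℂ H]
    [CompleteSpace H] where
  /-- The underlying symmetric operator. -/
  A : H →ₗ.[ℂ] H
  /-- The main operator. -/
  T : H →ₗ.[ℂ] H
  /-- The state-space operator. -/
  stateOp : Hplus A →L[ℂ] Hminus A
  /-- The channel operator. -/
  K : ℂ →L[ℂ] Hminus A
  closedSymmetric : IsClosedSymmetric A
  deficiency : HasEqualFiniteDeficiency A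
  prime : IsPrime A
  classLambda : ClassLambda A T
  starExt : IsStarExt T stateOp
  im_eq : ∀ f : Hplus A, biIm stateOp f = K (channelAdj K f)
  range_eq : LinearMap.range (K : ℂ →ₗ[ℂ] Hminus A) =
    LinearMap.range (biIm stateOp : Hplus A →ₗ[ℂ] Hminus A)

/-- `(𝔹 - z I)⁻¹ φ` for `𝔹 ∈ [H₊, H₋]` and `φ ∈ H₋`: the solution `x ∈ H₊` of
`𝔹 x - z x = φ` (used where this solution exists and is unique). -/
def biResolvent {A : H →ₗ.[ℂ] H} (B : Hplus A →L[ℂ] Hminus A) (z : ℂ) (φ : Hminus A) : Hplus A :=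
  Function.invFun (fun x : Hplus A => B x - z • toMinus A (incl A x)) φ

/-- The transfer function `W(z) = 1 - 2 i K* (𝔸 - z I)⁻¹ K`, for `z ∈ ρ(T)`. -/
def LSystem.transfer (Θ : LSystem H) (z : ℂ) : ℂ :=
  1 - 2 * Complex.I * channelAdj Θ.K (biResolvent Θ.stateOp z (Θ.K 1))

/-- The impedance function `V(z) = K* (Re 𝔸 - z I)⁻¹ K`, for `z` in the resolvent set of the
quasi-kernel of `Re 𝔸`, in particular for all non-real `z`. -/
def LSystem.impedance (Θ : LSystem H) (z : ℂ) : ℂ :=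
  channelAdj Θ.K (biResolvent (biRe Θ.stateOp) z (Θ.K 1))

/-- `Θ'` is a unimodular transformation of `Θ` with parameter `α`: the transfer functions satisfy
`W_{Θ'}(z) = W_Θ(z) (-e^{2 i α})` at every point where both are defined. -/
def IsUnimodularTransformation {H' : Type*} [NormedAddCommGroup H'] [InnerProductSpace ℂ H']
    [CompleteSpace H'] (Θ : LSystem H) (Θ' : LSystem H') (α : ℝ) : Prop :=
  ∀ z ∈ resolvent Θ.T ∩ resolvent Θ'.T,
    Θ'.transfer z = Θ.transfer z * (-Complex.exp (2 * Complex.I * α))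

/-- The perturbed Donoghue class `𝔐^{-1,Q}_κ`: functions on the upper half-plane of the form
`V(z) = Q + ∫ (1/(λ - z) - λ/(1 + λ²)) dμ(λ)` with an infinite Borel measure `μ` such that
`∫ dμ(λ)/(1 + λ²) = (1 + κ)/(1 - κ)`. -/
def MInvClass (κ Q : ℝ) (V : ℂ → ℂ) : Prop :=
  ∃ μ : Measure ℝ, μ Set.univ = ⊤ ∧
    ∫⁻ t : ℝ, ENNReal.ofReal (1 / (1 + t ^ 2)) ∂μ = ENNReal.ofReal ((1 + κ) / (1 - κ)) ∧
    ∀ z : ℂ, 0 < z.im →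
      V z = Q + ∫ t : ℝ, (1 / ((t : ℂ) - z) - (t : ℂ) / (1 + (t : ℂ) ^ 2)) ∂μ

end LSys

end

/-! Since `Im 𝔸 = KK*` has rank one, `W = (1 - iV)/(1 + iV)`. Multiplying `W` by `-e^{2iα}`
therefore rotates the impedance: with `c = cos α`, `s = sin α`, the new impedance is `V' = (c +
sV)/(s - cV)` (`IsUnimodularTransformation.impedance_mul`).

The Cauchy kernel at `i` is `i/(1 + t²)`, so membership of `V` in the class forces `V(i) = Q + ia`.
Requiring `V'(i) = -Q + ia` in the rotation formula gives an identity in the imaginary part and `cb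
= 2Qs` in the real part; this is the tangent condition, as `c ≠ 0`.

Conversely, `V'` is a Nevanlinna function, so it has a representation with a linear coefficient `γ`
and a measure `ν`; its value at `i` fixes the constant and `γ + ∫ dν/(1 + t²)`. It remains to see
that `γ = 0` and that `ν` is infinite (`moebius_no_linear_term_and_infinite`). This follows from `(s
- cV)(s + cV') = 1` along `iy`, `y → ∞`: a linear term or a finite `ν` would make `V` either
approach a real limit at rate `1/y`, forcing `μ` to be finite, or grow linearly, which its
representation excludes. -/

noncomputable section

namespace LSys

open Filter Topology

/-! ### Cauchy transforms of measures on the line. -/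

/-- The regularized Cauchy kernel. -/
def cauchyKer (z : ℂ) (t : ℝ) : ℂ := 1 / ((t : ℂ) - z) - (t : ℂ) / (1 + (t : ℂ) ^ 2)

theorem one_add_sq_ne_zero (t : ℝ) : (1 + (t : ℂ) ^ 2) ≠ 0 := by
  have : (1 + t ^ 2 : ℝ) ≠ 0 := by positivity
  exact_mod_cast this

theorem ofReal_sub_ne_zero {z : ℂ} (hz : z.im ≠ 0) (t : ℝ) : (t : ℂ) - z ≠ 0 := by
  intro h
  have := congrArg Complex.im h
  simp at this
  exact hz this

theorem im_le_norm_ofReal_sub (z : ℂ) (t : ℝ) : z.im ≤ ‖(t : ℂ) - z‖ := by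
  have := Complex.abs_im_le_norm ((t : ℂ) - z)
  simp only [Complex.sub_im, Complex.ofReal_im, zero_sub, abs_neg] at this
  exact (le_abs_self _).trans this

theorem norm_ofReal_sub_I_sq (t : ℝ) : ‖(t : ℂ) - Complex.I‖ ^ 2 = 1 + t ^ 2 := by
  rw [← Complex.normSq_eq_norm_sq, Complex.normSq_apply]; simp; ring

/-- Uniform in `z` for given `d` and `M`, hence a dominating bound for differentiation under the
integral; it compares `|t - i|` with `|t - z| ≥ d`. -/
theorem one_add_sq_le {z : ℂ} {d M : ℝ} (hd : 0 < d) (hz : d ≤ z.im) (hM : ‖z - Complex.I‖ ≤ M)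
    (t : ℝ) : 1 + t ^ 2 ≤ (1 + M / d) ^ 2 * ‖(t : ℂ) - z‖ ^ 2 := by
  have h1 := hz.trans (im_le_norm_ofReal_sub z t)
  have hM0 : 0 ≤ M := (norm_nonneg _).trans hM
  have h2 : ‖(t : ℂ) - Complex.I‖ ≤ (1 + M / d) * ‖(t : ℂ) - z‖ := by
    calc ‖(t : ℂ) - Complex.I‖ = ‖((t : ℂ) - z) + (z - Complex.I)‖ := by ring_nf
      _ ≤ ‖(t : ℂ) - z‖ + M := (norm_add_le _ _).trans (by gcongr)
      _ = ‖(t : ℂ) - z‖ + M / d * d := by field_simp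
      _ ≤ ‖(t : ℂ) - z‖ + M / d * ‖(t : ℂ) - z‖ := by gcongr
      _ = _ := by ring
  rw [← norm_ofReal_sub_I_sq, ← mul_pow]
  gcongr

theorem cauchyKer_eq {z : ℂ} (hz : z.im ≠ 0) (t : ℝ) :
    cauchyKer z t = (1 + t * z) / (((t : ℂ) - z) * (1 + (t : ℂ) ^ 2)) := by
  have h1 := ofReal_sub_ne_zero hz t
  have h2 := one_add_sq_ne_zero t
  rw [cauchyKer]; field_simp; ring

theorem measurable_cauchyKer (z : ℂ) : Measurable (cauchyKer z) := by
  unfold cauchyKer; fun_prop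

theorem norm_one_add_sq (t : ℝ) : ‖(1 + (t : ℂ) ^ 2)‖ = 1 + t ^ 2 := by
  rw [show (1 + (t : ℂ) ^ 2) = ((1 + t ^ 2 : ℝ) : ℂ) by push_cast; rfl, Complex.norm_real,
    Real.norm_of_nonneg (by positivity)]

theorem norm_one_add_mul_le (z : ℂ) (t : ℝ) :
    ‖1 + (t : ℂ) * z‖ ≤ ‖z‖ * ‖(t : ℂ) - z‖ + ‖1 + z ^ 2‖ := by
  calc ‖1 + (t : ℂ) * z‖ = ‖z * ((t : ℂ) - z) + (1 + z ^ 2)‖ := by ring_nf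
    _ ≤ _ := (norm_add_le _ _).trans (by rw [norm_mul])

/-- The numerator is `1 + tz = z(t - z) + (1 + z²)`, and `|t - z| ≥ Im z`. -/
theorem norm_cauchyKer_le {z : ℂ} (hz : 0 < z.im) (t : ℝ) :
    ‖cauchyKer z t‖ ≤ (‖z‖ + ‖1 + z ^ 2‖ / z.im) * (1 / (1 + t ^ 2)) := by
  rw [cauchyKer_eq hz.ne', norm_div, norm_mul, norm_one_add_sq]
  have h1 := im_le_norm_ofReal_sub z t
  have h0 : 0 < ‖(t : ℂ) - z‖ := hz.trans_le h1
  rw [mul_one_div, ← div_div]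
  gcongr
  rw [div_le_iff₀ h0]
  refine (norm_one_add_mul_le z t).trans ?_
  rw [add_mul]
  gcongr
  rw [div_mul_eq_mul_div, le_div_iff₀ hz]
  gcongr

variable {μ : Measure ℝ}

theorem integrable_cauchyKer (hμ : Integrable (fun t : ℝ => 1 / (1 + t ^ 2)) μ) {z : ℂ}
    (hz : 0 < z.im) : Integrable (cauchyKer z) μ :=
  (hμ.const_mul _).mono' (measurable_cauchyKer z).aestronglyMeasurable
    (.of_forall fun t => norm_cauchyKer_le hz t)

theorem cauchyKer_im (z : ℂ) (t : ℝ) : (cauchyKer z t).im = z.im / ‖(t : ℂ) - z‖ ^ 2 := by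
  have h : ((t : ℂ) / (1 + (t : ℂ) ^ 2)).im = 0 := by
    rw [show (t : ℂ) / (1 + (t : ℂ) ^ 2) = ((t / (1 + t ^ 2) : ℝ) : ℂ) by push_cast; rfl]
    exact Complex.ofReal_im _
  rw [cauchyKer, Complex.sub_im, h, sub_zero, one_div, Complex.inv_im, Complex.normSq_eq_norm_sq]
  simp

theorem integral_cauchyKer_im (hμ : Integrable (fun t : ℝ => 1 / (1 + t ^ 2)) μ) {z : ℂ}
    (hz : 0 < z.im) : (∫ t, cauchyKer z t ∂μ).im = ∫ t : ℝ, z.im / ‖(t : ℂ) - z‖ ^ 2 ∂μ := by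
  have := integral_im (𝕜 := ℂ) (integrable_cauchyKer hμ hz)
  simp only [RCLike.im_eq_complex_im, cauchyKer_im] at this
  exact this.symm

theorem integrable_im_div (hμ : Integrable (fun t : ℝ => 1 / (1 + t ^ 2)) μ) {z : ℂ}
    (hz : 0 < z.im) : Integrable (fun t : ℝ => z.im / ‖(t : ℂ) - z‖ ^ 2) μ := by
  have := (integrable_cauchyKer hμ hz).im
  simpa only [RCLike.im_eq_complex_im, cauchyKer_im] using this

theorem integral_cauchyKer_im_pos (hμ : Integrable (fun t : ℝ => 1 / (1 + t ^ 2)) μ)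
    (h0 : μ ≠ 0) {z : ℂ} (hz : 0 < z.im) : 0 < (∫ t, cauchyKer z t ∂μ).im := by
  rw [integral_cauchyKer_im hμ hz, integral_pos_iff_support_of_nonneg _ (integrable_im_div hμ hz)]
  · have : (Function.support fun t : ℝ => z.im / ‖(t : ℂ) - z‖ ^ 2) = Set.univ := by
      ext t
      have := ofReal_sub_ne_zero hz.ne' t
      simp [hz.ne', this]
    rw [this]
    simpa [pos_iff_ne_zero] using h0
  · intro t; positivity

theorem cauchyKer_I (t : ℝ) : cauchyKer Complex.I t = ((1 / (1 + t ^ 2) : ℝ) : ℂ) * Complex.I := by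
  rw [cauchyKer_eq (by simp)]
  have h1 := ofReal_sub_ne_zero (z := Complex.I) (by simp) t
  have h2 := one_add_sq_ne_zero t
  push_cast
  rw [div_mul_eq_mul_div, div_eq_div_iff (mul_ne_zero h1 h2) h2]
  linear_combination (1 + (t : ℂ) ^ 2) * Complex.I_sq

theorem integral_cauchyKer_I :
    ∫ t, cauchyKer Complex.I t ∂μ = ((∫ t : ℝ, 1 / (1 + t ^ 2) ∂μ : ℝ) : ℂ) * Complex.I := by
  simp_rw [cauchyKer_I]
  rw [integral_mul_const, integral_complex_ofReal]

theorem hasDerivAt_integral_cauchyKer (hμ : Integrable (fun t : ℝ => 1 / (1 + t ^ 2)) μ) {z : ℂ}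
    (hz : 0 < z.im) : HasDerivAt (fun w => ∫ t, cauchyKer w t ∂μ)
      (∫ t : ℝ, 1 / ((t : ℂ) - z) ^ 2 ∂μ) z := by
  -- On the ball of this radius the imaginary part stays at least `d`.
  set d := z.im / 2 with hd
  have hd0 : 0 < d := by positivity
  set M := ‖z - Complex.I‖ + d
  have hball : ∀ w ∈ Metric.ball z d, d ≤ w.im ∧ ‖w - Complex.I‖ ≤ M := by
    intro w hw
    rw [mem_ball_iff_norm] at hw
    constructor
    · have := (Complex.abs_im_le_norm (w - z)).trans hw.le
      rw [abs_le] at this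
      simp only [Complex.sub_im] at this
      linarith [this.1]
    · calc ‖w - Complex.I‖ = ‖(z - Complex.I) + (w - z)‖ := by ring_nf
        _ ≤ _ := (norm_add_le _ _).trans (add_le_add le_rfl hw.le)
  refine (hasDerivAt_integral_of_dominated_loc_of_deriv_le (s := Metric.ball z d)
    (bound := fun t => (1 + M / d) ^ 2 * (1 / (1 + t ^ 2)))
    (F' := fun w (t : ℝ) => 1 / ((t : ℂ) - w) ^ 2)
    (Metric.ball_mem_nhds z hd0)
    (.of_forall fun w => (measurable_cauchyKer w).aestronglyMeasurable)
    (integrable_cauchyKer hμ hz) ?_ (.of_forall fun t w hw => ?_) (hμ.const_mul _)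
    (.of_forall fun t w hw => ?_)).2
  · exact Measurable.aestronglyMeasurable (by fun_prop)
  · obtain ⟨h1, h2⟩ := hball w hw
    have h3 := one_add_sq_le hd0 h1 h2 t
    have h4 : 0 < ‖(t : ℂ) - w‖ := hd0.trans_le (h1.trans (im_le_norm_ofReal_sub w t))
    rw [norm_div, norm_pow, norm_one, mul_one_div, div_le_div_iff₀ (by positivity) (by positivity)]
    linarith
  · obtain ⟨h1, h2⟩ := hball w hw
    have h4 := ofReal_sub_ne_zero (hd0.trans_le h1).ne' t
    have h5 := ((hasDerivAt_id w).const_sub (t : ℂ)).inv h4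
    simp only [cauchyKer, one_div]
    have h6 := h5.sub_const ((t : ℂ) / (1 + (t : ℂ) ^ 2))
    simpa [id] using h6

/-! ### Behaviour along the imaginary axis at infinity. -/

theorem norm_ofReal_sub_mul_I_sq (t y : ℝ) :
    ‖(t : ℂ) - y * Complex.I‖ ^ 2 = t ^ 2 + y ^ 2 := by
  rw [← Complex.normSq_eq_norm_sq, Complex.normSq_apply]; simp; ring

theorem tendsto_inv_ofReal : Tendsto (fun y : ℝ => ((y : ℂ))⁻¹) atTop (𝓝 0) := by
  have := (Complex.continuous_ofReal.tendsto 0).comp tendsto_inv_atTop_zero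
  simpa [Function.comp_def] using this

theorem tendsto_inv_ofReal_sub (t : ℝ) :
    Tendsto (fun y : ℝ => 1 / ((t : ℂ) - y * Complex.I)) atTop (𝓝 0) := by
  rw [tendsto_zero_iff_norm_tendsto_zero]
  refine squeeze_zero' (.of_forall fun y => norm_nonneg _) ?_ tendsto_inv_atTop_zero
  filter_upwards [eventually_gt_atTop 0] with y hy
  rw [norm_div, norm_one, ← one_div]
  gcongr
  have := im_le_norm_ofReal_sub (y * Complex.I) t
  simpa using this

/-- A Cauchy transform has no linear term: for `y ≥ 1` the kernel divided by `y` is dominated by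
`1/(1 + t²)` and tends to zero pointwise. -/
theorem tendsto_integral_cauchyKer_div (hμ : Integrable (fun t : ℝ => 1 / (1 + t ^ 2)) μ) :
    Tendsto (fun y : ℝ => (∫ t, cauchyKer (y * Complex.I) t ∂μ) / y) atTop (𝓝 0) := by
  have key : Tendsto (fun y : ℝ => ∫ t, cauchyKer (y * Complex.I) t / y ∂μ) atTop
      (𝓝 (∫ _, (0 : ℂ) ∂μ)) := by
    refine tendsto_integral_filter_of_dominated_convergence (fun t => 1 / (1 + t ^ 2))
      (.of_forall fun y => ((measurable_cauchyKer _).div_const _).aestronglyMeasurable) ?_ hμ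
      (.of_forall fun t => ?_)
    · filter_upwards [eventually_ge_atTop 1] with y hy
      refine .of_forall fun t => ?_
      have hy0 : 0 < y := by linarith
      rw [cauchyKer_eq (by simpa using hy0.ne'), norm_div, norm_div, norm_mul, norm_one_add_sq,
        Complex.norm_real, Real.norm_of_nonneg hy0.le, div_div]
      have h1 : ‖1 + (t : ℂ) * (y * Complex.I)‖ ≤ ‖(t : ℂ) - y * Complex.I‖ * y := by
        refine abs_le_of_sq_le_sq' ?_ (by positivity) |>.2
        rw [mul_pow, norm_ofReal_sub_mul_I_sq, ← Complex.normSq_eq_norm_sq, Complex.normSq_apply]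
        have : 1 ≤ y ^ 2 := by nlinarith
        simp
        nlinarith
      have h0 : 0 < ‖(t : ℂ) - y * Complex.I‖ :=
        norm_pos_iff.mpr (ofReal_sub_ne_zero (by simpa using hy0.ne') t)
      rw [div_le_div_iff₀ (by positivity) (by positivity)]
      nlinarith [sq_nonneg t]
    · have := ((tendsto_inv_ofReal_sub t).sub_const ((t : ℂ) / (1 + (t : ℂ) ^ 2))).mul
        tendsto_inv_ofReal
      simpa [cauchyKer, div_eq_mul_inv] using this
  simpa [integral_div] using key

/-- The bounded quantity is `∫ y²/(t² + y²) dμ`, whose integrand is at least `1/2` on `[-y, y]`;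
Markov's inequality then bounds `μ [-y, y]` uniformly. -/
theorem measure_univ_lt_top_of_bounded (hμ : Integrable (fun t : ℝ => 1 / (1 + t ^ 2)) μ) {M : ℝ}
    (hM : ∀ᶠ y : ℝ in atTop, y * (∫ t, cauchyKer (y * Complex.I) t ∂μ).im ≤ M) :
    μ Set.univ < ⊤ := by
  have key : ∀ᶠ y : ℝ in atTop, μ (Set.Icc (-y) y) ≤ 2 * ENNReal.ofReal M := by
    filter_upwards [hM, eventually_gt_atTop 0] with y hy hy0
    have hz : 0 < ((y : ℂ) * Complex.I).im := by simpa using hy0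
    rw [integral_cauchyKer_im hμ hz, ← integral_const_mul] at hy
    have hint := (integrable_im_div hμ hz).const_mul y
    have h1 : ENNReal.ofReal (1 / 2) * μ (Set.Icc (-y) y) ≤ ENNReal.ofReal M := by
      calc ENNReal.ofReal (1 / 2) * μ (Set.Icc (-y) y)
          ≤ ENNReal.ofReal (1 / 2) * μ {t : ℝ | ENNReal.ofReal (1 / 2) ≤ ENNReal.ofReal
              (y * (((y : ℂ) * Complex.I).im / ‖(t : ℂ) - (y : ℂ) * Complex.I‖ ^ 2))} := by
            gcongr
            intro t ht
            apply ENNReal.ofReal_le_ofReal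
            rw [norm_ofReal_sub_mul_I_sq]
            simp only [Complex.mul_im, Complex.ofReal_re, Complex.I_im, mul_one, Complex.ofReal_im,
              Complex.I_re, mul_zero, add_zero]
            rw [mul_div_assoc', div_le_div_iff₀ (by norm_num) (by positivity)]
            nlinarith [ht.1, ht.2]
        _ ≤ _ := mul_meas_ge_le_lintegral₀ hint.aestronglyMeasurable.aemeasurable.ennreal_ofReal _
        _ = ENNReal.ofReal _ := (ofReal_integral_eq_lintegral_ofReal hint
            (.of_forall fun t => by positivity)).symm
        _ ≤ _ := ENNReal.ofReal_le_ofReal hy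
    calc μ (Set.Icc (-y) y) = 2 * (ENNReal.ofReal (1 / 2) * μ (Set.Icc (-y) y)) := by
          rw [← mul_assoc, show (2 : ENNReal) = ENNReal.ofReal 2 by simp,
            ← ENNReal.ofReal_mul (by norm_num)]
          norm_num
      _ ≤ _ := by gcongr
  have hU : (⋃ n : ℕ, Set.Icc (-(n : ℝ)) n) = Set.univ := by
    ext t
    simp only [Set.mem_iUnion, Set.mem_univ, iff_true]
    obtain ⟨n, hn⟩ := exists_nat_ge |t|
    exact ⟨n, abs_le.mp hn⟩
  have hmono : Monotone fun n : ℕ => Set.Icc (-(n : ℝ)) n := fun m n h => by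
    have : (m : ℝ) ≤ n := by exact_mod_cast h
    exact Set.Icc_subset_Icc (by linarith) this
  have hlim := tendsto_measure_iUnion_atTop (μ := μ) hmono
  rw [hU] at hlim
  refine (le_of_tendsto hlim (tendsto_natCast_atTop_atTop.eventually key)).trans_lt ?_
  exact ENNReal.mul_lt_top (by simp) (by simp)

/-- For finite `μ` the regularizing term integrates to a constant, and `y/(t - iy) → i` boundedly:
the transform approaches a real limit at rate `1/y`. -/
theorem tendsto_mul_integral_cauchyKer_sub [IsFiniteMeasure μ] :
    Tendsto (fun y : ℝ => (y : ℂ) * ((∫ t, cauchyKer (y * Complex.I) t ∂μ) -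
      ((-∫ t : ℝ, t / (1 + t ^ 2) ∂μ : ℝ) : ℂ))) atTop (𝓝 (μ.real Set.univ * Complex.I)) := by
  have hb : Integrable (fun t : ℝ => (t : ℂ) / (1 + (t : ℂ) ^ 2)) μ := by
    refine (integrable_const (1 : ℝ)).mono'
      (Measurable.aestronglyMeasurable (by fun_prop)) (.of_forall fun t => ?_)
    rw [norm_div, norm_one_add_sq, Complex.norm_real, Real.norm_eq_abs,
      div_le_one (by positivity)]
    nlinarith [sq_abs t, sq_nonneg (|t| - 1)]
  have hc : ((-∫ t : ℝ, t / (1 + t ^ 2) ∂μ : ℝ) : ℂ) =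
      -∫ t : ℝ, (t : ℂ) / (1 + (t : ℂ) ^ 2) ∂μ := by
    rw [Complex.ofReal_neg, ← integral_complex_ofReal]
    simp
  have key : Tendsto (fun y : ℝ => ∫ t : ℝ, y * (1 / ((t : ℂ) - y * Complex.I)) ∂μ) atTop
      (𝓝 (∫ _, Complex.I ∂μ)) := by
    refine tendsto_integral_filter_of_dominated_convergence (fun _ => 1)
      (.of_forall fun y => Measurable.aestronglyMeasurable (by fun_prop)) ?_ (integrable_const _)
      (.of_forall fun t => ?_)
    · filter_upwards [eventually_gt_atTop 0] with y hy
      refine .of_forall fun t => ?_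
      have := im_le_norm_ofReal_sub (y * Complex.I) t
      simp only [Complex.mul_im, Complex.ofReal_re, Complex.I_im, mul_one, Complex.ofReal_im,
              Complex.I_re, mul_zero, add_zero] at this
      rw [norm_mul, norm_div, norm_one, Complex.norm_real, Real.norm_of_nonneg hy.le, mul_one_div,
        div_le_one (hy.trans_le this)]
      exact this
    -- Uses `y/(t - iy) = i - it/(t - iy)`.
    · have h1 := ((tendsto_inv_ofReal_sub t).const_mul (-Complex.I * t)).const_add Complex.I
      rw [mul_zero, add_zero] at h1
      refine h1.congr' ?_
      filter_upwards [eventually_gt_atTop 0] with y hy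
      have := ofReal_sub_ne_zero (z := y * Complex.I) (by simpa using hy.ne') t
      rw [mul_one_div, mul_one_div, eq_div_iff this, add_mul, div_mul_cancel₀ _ this]
      linear_combination -(y : ℂ) * Complex.I_sq
  rw [integral_const, Complex.real_smul] at key
  refine key.congr' ?_
  filter_upwards [eventually_gt_atTop 0] with y hy
  have h1 : Integrable (fun t : ℝ => 1 / ((t : ℂ) - y * Complex.I)) μ := by
    refine (integrable_const (1 / y)).mono'
      (Measurable.aestronglyMeasurable (by fun_prop)) (.of_forall fun t => ?_)
    have := im_le_norm_ofReal_sub (y * Complex.I) t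
    rw [norm_div, norm_one]
    gcongr
    simpa using this
  rw [hc, integral_const_mul]
  simp only [cauchyKer]
  rw [integral_sub h1 hb]
  ring

/-! ### Herglotz representation on the disc. -/

instance : MeasurableSpace Circle := borel Circle

instance : BorelSpace Circle := ⟨rfl⟩

theorem continuous_poissonKernel_circle {w : ℂ} (hw : ‖w‖ < 1) :
    Continuous fun ζ : Circle => poissonKernel 0 w ζ := by
  simp only [poissonKernel_def, sub_zero]
  refine Continuous.div (by fun_prop) (by fun_prop) fun ζ => ?_
  have : (ζ : ℂ) - w ≠ 0 := by
    intro h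
    rw [sub_eq_zero] at h
    rw [← h, Circle.norm_coe] at hw
    exact lt_irrefl _ hw
  simpa using this

/-- A function that is holomorphic on a neighbourhood of the closed disc and has nonnegative real
part is represented by a finite measure on the circle. -/
theorem exists_finiteMeasure_of_diffContOnCl {f : ℂ → ℂ}
    (hf : DiffContOnCl ℂ f (Metric.ball 0 1)) (hpos : ∀ w ∈ Metric.closedBall 0 1, 0 ≤ (f w).re) :
    ∃ ν : FiniteMeasure Circle, ∀ w ∈ Metric.ball (0 : ℂ) 1,
      (f w).re = ∫ ζ : Circle, poissonKernel 0 w ζ ∂(ν : Measure Circle) := by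
  have hfc : ContinuousOn f (Metric.closedBall 0 1) := by
    have := hf.continuousOn
    rwa [closure_ball _ one_ne_zero] at this
  -- The representing measure is `Re f dθ/2π` on the circle; the factor is that of the circle
  -- average.
  set d : ℝ → ℝ := fun θ => (2 * Real.pi)⁻¹ * (f (circleMap 0 1 θ)).re with hd
  have hmem : ∀ θ, circleMap 0 1 θ ∈ Metric.closedBall (0 : ℂ) 1 := fun θ => by simp
  have hdc : Continuous d := by
    have : Continuous fun θ => f (circleMap 0 1 θ) :=
      hfc.comp_continuous (continuous_circleMap 0 1) hmem
    exact continuous_const.mul (Complex.continuous_re.comp this)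
  have hd0 : ∀ θ, 0 ≤ d θ := fun θ => mul_nonneg (by positivity) (hpos _ (hmem θ))
  set m := (volume.restrict (Set.Ioc 0 (2 * Real.pi))).withDensity fun θ => ENNReal.ofReal (d θ)
  have hm : IsFiniteMeasure m := by
    apply isFiniteMeasure_withDensity_ofReal
    exact (hdc.integrableOn_Ioc).2
  have hexp : Measurable fun θ : ℝ => Circle.exp θ := (Circle.exp.continuous).measurable
  refine ⟨⟨m.map fun θ : ℝ => Circle.exp θ, inferInstance⟩, fun w hw => ?_⟩
  have hw' : ‖w‖ < 1 := by simpa using hw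
  have hP := continuous_poissonKernel_circle hw'
  simp only [FiniteMeasure.toMeasure_mk]
  rw [integral_map hexp.aemeasurable hP.aestronglyMeasurable,
    integral_withDensity_eq_integral_toReal_smul (by fun_prop) (by simp)]
  have h1 := hf.circleAverage_poissonKernel_smul hw
  rw [Real.circleAverage_def] at h1
  have hi : IntervalIntegrable (fun θ => (poissonKernel 0 w • f) (circleMap 0 1 θ)) volume 0
      (2 * Real.pi) := by
    apply Continuous.intervalIntegrable
    have h3 : Continuous fun θ : ℝ => poissonKernel 0 w (circleMap 0 1 θ) := by
      have := hP.comp Circle.exp.continuous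
      simpa [Function.comp_def, circleMap] using this
    exact h3.smul (hfc.comp_continuous (continuous_circleMap 0 1) hmem)
  rw [← h1, Complex.smul_re, ← Complex.reCLM_apply, ← Complex.reCLM.intervalIntegral_comp_comm hi,
    intervalIntegral.integral_of_le (by positivity), smul_eq_mul, ← integral_const_mul]
  refine integral_congr_ae (.of_forall fun θ => ?_)
  beta_reduce
  rw [ENNReal.toReal_ofReal (hd0 θ)]
  simp only [hd, smul_eq_mul, Complex.reCLM_apply, Pi.smul_apply', Complex.smul_re, Circle.coe_exp,
    circleMap]
  simp
  ring

/-- The Herglotz representation on the disc, in terms of real parts. -/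
theorem exists_finiteMeasure_re_eq_poisson {f : ℂ → ℂ}
    (hf : DifferentiableOn ℂ f (Metric.ball 0 1)) (hpos : ∀ w ∈ Metric.ball 0 1, 0 ≤ (f w).re) :
    ∃ ν : FiniteMeasure Circle, ∀ w ∈ Metric.ball (0 : ℂ) 1,
      (f w).re = ∫ ζ : Circle, poissonKernel 0 w ζ ∂(ν : Measure Circle) := by
  -- The dilations `f(r_n w)` are holomorphic near the closed disc, so each has a representing
  -- measure.
  set r : ℕ → ℝ := fun n => 1 - 1 / ((n : ℝ) + 1) with hr
  have hr0 : ∀ n, 0 ≤ r n := fun n => by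
    simp only [hr, sub_nonneg]
    rw [div_le_one (by positivity)]
    linarith [Nat.cast_nonneg (α := ℝ) n]
  have hr1 : ∀ n, r n < 1 := fun n => by
    simp only [hr]
    have : 0 < 1 / ((n : ℝ) + 1) := by positivity
    linarith
  have hmaps : ∀ n, Set.MapsTo (fun w : ℂ => (r n : ℂ) * w) (Metric.closedBall 0 1)
      (Metric.ball 0 1) := by
    intro n w hw
    simp only [mem_closedBall_zero_iff] at hw
    simp only [mem_ball_zero_iff, norm_mul, Complex.norm_real, Real.norm_of_nonneg (hr0 n)]
    calc r n * ‖w‖ ≤ r n * 1 := by gcongr; exact hr0 n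
      _ < 1 := by simpa using hr1 n
  have hex : ∀ n, ∃ ν : FiniteMeasure Circle, ∀ w ∈ Metric.ball (0 : ℂ) 1,
      (f (r n * w)).re = ∫ ζ : Circle, poissonKernel 0 w ζ ∂(ν : Measure Circle) := by
    intro n
    refine exists_finiteMeasure_of_diffContOnCl (f := fun w => f (r n * w)) ?_
      fun w hw => hpos _ (hmaps n hw)
    apply DifferentiableOn.diffContOnCl
    rw [closure_ball _ one_ne_zero]
    exact hf.comp (by fun_prop) (hmaps n)
  choose ν hν using hex
  -- The Poisson kernel at the centre is `1`, so every measure has mass `Re f(0)`; sets of bounded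
  -- mass are weakly compact.
  have hmass : ∀ n, ν n ∈ {μ : FiniteMeasure Circle | μ.mass ≤ (f 0).re.toNNReal} := by
    intro n
    have h := hν n 0 (by simp)
    simp [poissonKernel_def] at h
    show (ν n).mass ≤ _
    rw [h, Real.le_toNNReal_iff_coe_le (by positivity)]
  have hcomp := isCompact_setOfPred_finiteMeasure_le_of_compactSpace Circle (f 0).re.toNNReal
  -- A limit along an ultrafilter replaces the extraction of a convergent subsequence.
  set U : Ultrafilter ℕ := Ultrafilter.of atTop
  obtain ⟨ν₀, -, hν₀⟩ := isCompact_iff_ultrafilter_le_nhds.mp hcomp (U.map ν)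
    (by
      rw [le_principal_iff]
      exact mem_map.mpr (Filter.Eventually.of_forall hmass))
  refine ⟨ν₀, fun w hw => ?_⟩
  have ht : Tendsto ν U (𝓝 ν₀) := hν₀
  have hP := continuous_poissonKernel_circle (w := w) (by simpa using hw)
  have h1 := (FiniteMeasure.tendsto_iff_forall_integral_tendsto.mp ht)
    (BoundedContinuousFunction.mkOfCompact ⟨_, hP⟩)
  simp only [BoundedContinuousFunction.mkOfCompact_apply, ContinuousMap.coe_mk] at h1
  simp_rw [← hν _ w hw] at h1
  have h2 : Tendsto (fun n => (f (r n * w)).re) atTop (𝓝 (f w).re) := by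
    have hrt : Tendsto (fun n => (r n : ℂ) * w) atTop (𝓝 w) := by
      have := tendsto_one_div_add_atTop_nhds_zero_nat (𝕜 := ℝ)
      have h3 : Tendsto r atTop (𝓝 1) := by simpa [hr] using this.const_sub 1
      have h4 := ((Complex.continuous_ofReal.tendsto 1).comp h3).mul_const w
      simpa [Function.comp_def] using h4
    exact (Complex.continuous_re.tendsto _).comp
      (((hf.continuousOn).continuousAt (Metric.isOpen_ball.mem_nhds hw)).tendsto.comp hrt)
  exact tendsto_nhds_unique (h2.mono_left (Ultrafilter.of_le _)) h1

/-! ### Transfer to the upper half-plane and Nevanlinna representation. -/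

/-- The Cayley map from the disc to the upper half-plane. -/
def cayley (w : ℂ) : ℂ := Complex.I * (1 + w) / (1 - w)

theorem cayley_im {w : ℂ} (hw : w ≠ 1) : (cayley w).im = (1 - ‖w‖ ^ 2) / ‖1 - w‖ ^ 2 := by
  have h : Complex.normSq (1 - w) ≠ 0 := by
    rw [Ne, Complex.normSq_eq_zero, sub_eq_zero]; exact fun h => hw h.symm
  rw [cayley, Complex.div_im, ← Complex.normSq_eq_norm_sq, ← Complex.normSq_eq_norm_sq, ← sub_div]
  congr 1
  simp [Complex.normSq_apply]
  ring

theorem ne_one_of_norm_lt_one {w : ℂ} (hw : ‖w‖ < 1) : w ≠ 1 := by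
  rintro rfl; simp at hw

theorem norm_one_sub_pos {w : ℂ} (hw : w ≠ 1) : 0 < ‖1 - w‖ :=
  norm_pos_iff.mpr (sub_ne_zero.mpr hw.symm)

theorem cayley_im_pos {w : ℂ} (hw : ‖w‖ < 1) : 0 < (cayley w).im := by
  have h1 := ne_one_of_norm_lt_one hw
  have := norm_one_sub_pos h1
  rw [cayley_im h1]
  have : ‖w‖ ^ 2 < 1 := by nlinarith [norm_nonneg w]
  apply div_pos (by linarith) (by positivity)

theorem exists_cayley_eq {z : ℂ} (hz : 0 < z.im) : ∃ w : ℂ, ‖w‖ < 1 ∧ cayley w = z := by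
  have h0 : z + Complex.I ≠ 0 := by
    intro h
    have := congrArg Complex.im h
    simp at this
    linarith
  refine ⟨(z - Complex.I) / (z + Complex.I), ?_, ?_⟩
  · rw [norm_div, div_lt_one (norm_pos_iff.mpr h0)]
    rw [← sq_lt_sq₀ (norm_nonneg _) (norm_nonneg _), ← Complex.normSq_eq_norm_sq,
      ← Complex.normSq_eq_norm_sq, Complex.normSq_apply, Complex.normSq_apply]
    simp
    nlinarith
  · have h1 : 1 - (z - Complex.I) / (z + Complex.I) = 2 * Complex.I / (z + Complex.I) := by
      field_simp; ring
    rw [cayley, h1]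
    field_simp
    ring

theorem cayley_circle {ζ : Circle} (hζ : ζ ≠ 1) : (((cayley ζ).re : ℝ) : ℂ) = cayley ζ := by
  have h : (ζ : ℂ) ≠ 1 := fun h => hζ (Circle.coe_eq_one.mp h)
  apply Complex.ext
  · simp
  · rw [cayley_im h, Circle.norm_coe]; simp

/-- Follows from `cayley ζ - cayley w = 2i(ζ - w)/((1 - ζ)(1 - w))`, used also at `w = 0`, where
`cayley` is `i`. The factor `1 + t²` becomes the density in `lineMeasure`. -/
theorem poissonKernel_circle_eq {ζ : Circle} (hζ : ζ ≠ 1) {w : ℂ} (hw : ‖w‖ < 1) :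
    poissonKernel 0 w ζ = (1 + (cayley ζ).re ^ 2) *
      ((cayley w).im / ‖(((cayley ζ).re : ℝ) : ℂ) - cayley w‖ ^ 2) := by
  have h : (ζ : ℂ) ≠ 1 := fun h => hζ (Circle.coe_eq_one.mp h)
  have hw1 := ne_one_of_norm_lt_one hw
  have a1 := sub_ne_zero.mpr h.symm
  have a2 := sub_ne_zero.mpr hw1.symm
  have n1 := norm_one_sub_pos h
  have n2 := norm_one_sub_pos hw1
  have e1 : cayley ζ - cayley w = 2 * Complex.I * (ζ - w) / ((1 - ζ) * (1 - w)) := by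
    rw [cayley, cayley]; field_simp; ring
  have e2 : cayley ζ - Complex.I = 2 * Complex.I * ζ / (1 - ζ) := by
    rw [cayley]; field_simp; ring
  have n3 : 0 < ‖(ζ : ℂ) - w‖ := by
    rw [norm_pos_iff, sub_ne_zero]
    rintro rfl
    rw [Circle.norm_coe] at hw
    exact lt_irrefl _ hw
  rw [← norm_ofReal_sub_I_sq, cayley_circle hζ, e1, e2, cayley_im hw1, poissonKernel_def]
  simp only [sub_zero, norm_div, norm_mul, Complex.norm_ofNat, Complex.norm_I]
  rw [Circle.norm_coe]
  field_simp

/-- The point `1` corresponds to infinity: an atom there produces the linear term. -/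
theorem poissonKernel_one {w : ℂ} (hw : ‖w‖ < 1) : poissonKernel 0 w 1 = (cayley w).im := by
  rw [cayley_im (ne_one_of_norm_lt_one hw), poissonKernel_def]
  simp

/-- The measure on the real line corresponding to a measure on the circle. -/
def lineMeasure (ν : Measure Circle) : Measure ℝ :=
  ((ν.restrict {1}ᶜ).map fun ζ : Circle => (cayley ζ).re).withDensity
    fun t => ENNReal.ofReal (1 + t ^ 2)

theorem measurable_cayley_re : Measurable fun ζ : Circle => (cayley ζ).re := by
  have h : Measurable fun ζ : Circle => (ζ : ℂ) := Continuous.measurable (by fun_prop)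
  unfold cayley
  fun_prop

theorem integrable_lineMeasure (ν : Measure Circle) [IsFiniteMeasure ν] :
    Integrable (fun t : ℝ => 1 / (1 + t ^ 2)) (lineMeasure ν) := by
  rw [lineMeasure, integrable_withDensity_iff_integrable_smul' (by fun_prop) (by simp)]
  refine (integrable_const (1 : ℝ)).congr (.of_forall fun t => ?_)
  have : 0 < 1 + t ^ 2 := by positivity
  simp only [ENNReal.toReal_ofReal this.le, smul_eq_mul]
  field_simp

theorem integral_lineMeasure (ν : Measure Circle) [IsFiniteMeasure ν] {w : ℂ} (hw : ‖w‖ < 1) :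
    ∫ ζ : Circle, poissonKernel 0 w ζ ∂ν = ν.real {1} * (cayley w).im +
      ∫ t : ℝ, (cayley w).im / ‖(t : ℂ) - cayley w‖ ^ 2 ∂(lineMeasure ν) := by
  have hP := continuous_poissonKernel_circle hw
  have hint : Integrable (fun ζ : Circle => poissonKernel 0 w ζ) ν := by
    have := (BoundedContinuousFunction.mkOfCompact ⟨_, hP⟩).integrable ν
    simpa using! this
  rw [← integral_add_compl (measurableSet_singleton (1 : Circle)) hint, integral_singleton,
    lineMeasure, integral_withDensity_eq_integral_toReal_smul (by fun_prop) (by simp),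
    integral_map measurable_cayley_re.aemeasurable
      (Measurable.aestronglyMeasurable (by fun_prop))]
  congr 1
  · simp [poissonKernel_one hw]
  · refine setIntegral_congr_fun (measurableSet_singleton _).compl fun ζ hζ => ?_
    have : 0 < 1 + (cayley ζ).re ^ 2 := by positivity
    simp only [ENNReal.toReal_ofReal this.le, smul_eq_mul]
    exact poissonKernel_circle_eq hζ hw

theorem isOpen_upper : IsOpen {z : ℂ | 0 < z.im} := isOpen_lt continuous_const Complex.continuous_im

theorem differentiableOn_integral_cauchyKer {μ : Measure ℝ}
    (hμ : Integrable (fun t : ℝ => 1 / (1 + t ^ 2)) μ) :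
    DifferentiableOn ℂ (fun w => ∫ t, cauchyKer w t ∂μ) {z : ℂ | 0 < z.im} := fun _ hz =>
  (hasDerivAt_integral_cauchyKer hμ hz).differentiableAt.differentiableWithinAt

/-- The Herglotz–Nevanlinna representation. -/
theorem exists_nevanlinna_representation {F : ℂ → ℂ}
    (hF : DifferentiableOn ℂ F {z : ℂ | 0 < z.im}) (hpos : ∀ z : ℂ, 0 < z.im → 0 ≤ (F z).im) :
    ∃ (γ : ℝ) (μ : Measure ℝ), 0 ≤ γ ∧ Integrable (fun t : ℝ => 1 / (1 + t ^ 2)) μ ∧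
      ∀ z : ℂ, 0 < z.im → F z = (F Complex.I).re + γ * z + ∫ t, cauchyKer z t ∂μ := by
  have hmaps : Set.MapsTo cayley (Metric.ball 0 1) {z : ℂ | 0 < z.im} := fun w hw =>
    cayley_im_pos (by simpa using hw)
  have hcd : DifferentiableOn ℂ cayley (Metric.ball 0 1) := by
    unfold cayley
    refine DifferentiableOn.div (by fun_prop) (by fun_prop) fun w hw => ?_
    exact sub_ne_zero.mpr (ne_one_of_norm_lt_one (by simpa using hw)).symm
  obtain ⟨ν, hν⟩ := exists_finiteMeasure_re_eq_poisson (f := fun w => -Complex.I * F (cayley w))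
    ((hF.comp hcd hmaps).const_mul _) (fun w hw => by simpa using hpos _ (hmaps hw))
  set μ := lineMeasure (ν : Measure Circle)
  have hμ : Integrable (fun t : ℝ => 1 / (1 + t ^ 2)) μ := integrable_lineMeasure _
  set γ := (ν : Measure Circle).real {1}
  refine ⟨γ, μ, by positivity, hμ, ?_⟩
  -- This difference is holomorphic with zero imaginary part, hence constant; at `i` the linear term
  -- and the integral are purely imaginary, so the constant is `Re F(i)`.
  set D : ℂ → ℂ := fun z => F z - γ * z - ∫ t, cauchyKer z t ∂μ with hD
  have him : ∀ z : ℂ, 0 < z.im → (D z).im = 0 := by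
    intro z hz
    obtain ⟨w, hw, rfl⟩ := exists_cayley_eq hz
    have h1 := hν w (by simpa using hw)
    rw [integral_lineMeasure _ hw] at h1
    change _ = γ * _ + _ at h1
    simp only [hD, Complex.sub_im, integral_cauchyKer_im hμ hz]
    simp at h1 ⊢
    linarith
  have hDd : DifferentiableOn ℂ D {z : ℂ | 0 < z.im} :=
    (hF.sub (by fun_prop)).sub (differentiableOn_integral_cauchyKer hμ)
  obtain ⟨C, hC⟩ := AnalyticOnNhd.eq_const_of_im_eq_const (c₀ := 0)
    (hDd.analyticOnNhd isOpen_upper) him isOpen_upper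
    ((convex_halfSpace_im_gt 0).isConnected ⟨Complex.I, by simp⟩)
  have hI := hC (x := Complex.I) (by simp)
  have hCr : C = (F Complex.I).re := by
    have h2 := him Complex.I (by simp)
    rw [hI] at h2
    apply Complex.ext
    · rw [← hI, hD]
      simp [integral_cauchyKer_I]
    · simpa using h2
  intro z hz
  have := hC (x := z) hz
  rw [← hCr, ← this, hD]
  ring


/-! ### Möbius rotations and the perturbed Donoghue classes. -/

theorem integrable_and_integral_eq_of_lintegral {a : ℝ} (ha : 0 ≤ a)
    (h : ∫⁻ t : ℝ, ENNReal.ofReal (1 / (1 + t ^ 2)) ∂μ = ENNReal.ofReal a) :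
    Integrable (fun t : ℝ => 1 / (1 + t ^ 2)) μ ∧ ∫ t : ℝ, 1 / (1 + t ^ 2) ∂μ = a := by
  have h0 : 0 ≤ᵐ[μ] fun t : ℝ => 1 / (1 + t ^ 2) := .of_forall fun t => by
    simp only [Pi.zero_apply]; positivity
  have hm : AEStronglyMeasurable (fun t : ℝ => 1 / (1 + t ^ 2)) μ :=
    Measurable.aestronglyMeasurable (by fun_prop)
  refine ⟨⟨hm, ?_⟩, ?_⟩
  · rw [hasFiniteIntegral_iff_ofReal h0, h]; simp
  · rw [integral_eq_lintegral_of_nonneg_ae h0 hm, h, ENNReal.toReal_ofReal ha]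

/-- The boundary behaviour at infinity of the Cauchy transform of an infinite measure. -/
theorem not_tendsto_mul_of_measure_univ_eq_top
    (hμ : Integrable (fun t : ℝ => 1 / (1 + t ^ 2)) μ) (hinf : μ Set.univ = ⊤)
    {c : ℝ} (hc : c ≠ 0) (s r : ℝ) (L : ℂ) :
    ¬ Tendsto (fun y : ℝ => (y : ℂ) * ((s - c * ∫ t, cauchyKer (y * Complex.I) t ∂μ) - r))
      atTop (𝓝 L) := by
  intro h
  -- The real constants drop out of the imaginary part, leaving `y Im ∫` bounded.
  have h1 := ((Complex.continuous_im.tendsto _).comp h).const_mul (-c⁻¹)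
  have h2 := (h1.eventually_lt_const (lt_add_one _)).mono fun y hy => hy.le
  refine (measure_univ_lt_top_of_bounded (M := -c⁻¹ * L.im + 1) hμ (h2.mono fun y hy => ?_)).ne hinf
  refine le_trans (le_of_eq ?_) hy
  simp
  field_simp

theorem tendsto_const_div_ofReal (w : ℂ) : Tendsto (fun y : ℝ => w / (y : ℂ)) atTop (𝓝 0) := by
  simpa [div_eq_mul_inv] using tendsto_inv_ofReal.const_mul w

/-- A real Möbius transformation of a Nevanlinna function with infinite measure and no linear term
is again of this form, provided it does not fix infinity. -/
theorem moebius_no_linear_term_and_infinite {ν : Measure ℝ}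
    (hμ : Integrable (fun t : ℝ => 1 / (1 + t ^ 2)) μ) (hinf : μ Set.univ = ⊤)
    (hν : Integrable (fun t : ℝ => 1 / (1 + t ^ 2)) ν) {c : ℝ} (hc : c ≠ 0) (p q γ : ℝ)
    (h : ∀ y : ℝ, 0 < y → (p - c * ∫ t, cauchyKer (y * Complex.I) t ∂μ) *
      (q + c * (γ * (y * Complex.I) + ∫ t, cauchyKer (y * Complex.I) t ∂ν)) = 1) :
    γ = 0 ∧ ν Set.univ = ⊤ := by
  set X : ℝ → ℂ := fun y => p - c * ∫ t, cauchyKer (y * Complex.I) t ∂μ with hX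
  have hcC : (c : ℂ) ≠ 0 := by exact_mod_cast hc
  -- Otherwise the second factor grows like `icγy`, so `y` times the first converges.
  have hγ : γ = 0 := by
    by_contra hγ
    have hγC : (γ : ℂ) ≠ 0 := by exact_mod_cast hγ
    have h1 : Tendsto (fun y : ℝ => (q + c * (γ * (y * Complex.I) +
        ∫ t, cauchyKer (y * Complex.I) t ∂ν)) / (y : ℂ)) atTop (𝓝 (c * γ * Complex.I)) := by
      have h2 := ((tendsto_integral_cauchyKer_div hν).const_mul (c : ℂ)).const_add
        ((c : ℂ) * γ * Complex.I) |>.add (tendsto_const_div_ofReal q)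
      simp only [mul_zero, add_zero] at h2
      refine h2.congr' ?_
      filter_upwards [eventually_gt_atTop 0] with y hy
      have : (y : ℂ) ≠ 0 := by exact_mod_cast hy.ne'
      field_simp
      ring
    have h3 := h1.inv₀ (by simp [hcC, hγC])
    refine not_tendsto_mul_of_measure_univ_eq_top hμ hinf hc p 0 _ (h3.congr' ?_)
    filter_upwards [eventually_gt_atTop 0] with y hy
    have h4 := h y hy
    rw [inv_div, Complex.ofReal_zero, sub_zero, div_eq_iff (right_ne_zero_of_mul_eq_one h4),
      mul_assoc, h4, mul_one]
  refine ⟨hγ, ?_⟩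
  subst hγ
  by_contra hfin
  have : IsFiniteMeasure ν := ⟨lt_top_iff_ne_top.mpr hfin⟩
  set Y : ℝ → ℂ := fun y => q + c * ∫ t, cauchyKer (y * Complex.I) t ∂ν with hY
  have hXY : ∀ y, 0 < y → X y * Y y = 1 := fun y hy => by simpa [hX, hY] using h y hy
  set C := -∫ t : ℝ, t / (1 + t ^ 2) ∂ν
  set l : ℝ := q + c * C with hl
  have h1 : Tendsto (fun y : ℝ => (y : ℂ) * (Y y - l)) atTop
      (𝓝 (c * (ν.real Set.univ * Complex.I))) := by
    refine ((tendsto_mul_integral_cauchyKer_sub (μ := ν)).const_mul (c : ℂ)).congr fun y => ?_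
    change (c : ℂ) * (y * (_ - (C : ℂ))) = _
    simp only [hY, hl, Complex.ofReal_add, Complex.ofReal_mul]
    ring
  -- If `l = 0`, then `1 = (X/y)(yY) → 0`. If not, `y(X - 1/l) = -y(Y - l)/(Yl)` converges, which an
  -- infinite `μ` forbids.
  by_cases hl0 : l = 0
  · have h2 : Tendsto (fun y : ℝ => X y / y) atTop (𝓝 0) := by
      have h3 := (tendsto_const_div_ofReal p).sub
        ((tendsto_integral_cauchyKer_div hμ).const_mul (c : ℂ))
      simp only [mul_zero, sub_zero] at h3
      exact h3.congr fun y => by simp only [hX]; ring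
    have h3 := h2.mul h1
    rw [zero_mul] at h3
    refine zero_ne_one (tendsto_nhds_unique (h3.congr' ?_) (tendsto_const_nhds (x := (1 : ℂ))))
    filter_upwards [eventually_gt_atTop 0] with y hy
    have : (y : ℂ) ≠ 0 := by exact_mod_cast hy.ne'
    rw [hl0, ← hXY y hy]
    field_simp
    simp
  · have hlC : (l : ℂ) ≠ 0 := by exact_mod_cast hl0
    have h2 : Tendsto Y atTop (𝓝 l) := by
      have h3 := (tendsto_inv_ofReal.mul h1).add_const (l : ℂ)
      rw [zero_mul, zero_add] at h3
      refine h3.congr' ?_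
      filter_upwards [eventually_gt_atTop 0] with y hy
      have : (y : ℂ) ≠ 0 := by exact_mod_cast hy.ne'
      field_simp
      ring
    have h4 := (h1.neg).div (h2.mul_const (l : ℂ)) (mul_ne_zero hlC hlC)
    refine not_tendsto_mul_of_measure_univ_eq_top hμ hinf hc p l⁻¹ _ (h4.congr' ?_)
    filter_upwards [eventually_gt_atTop 0] with y hy
    have h5 := hXY y hy
    have hY0 := right_ne_zero_of_mul_eq_one h5
    have : X y = (Y y)⁻¹ := eq_inv_of_mul_eq_one_left h5
    change _ = (y : ℂ) * (X y - _)
    rw [this]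
    simp only [Pi.div_apply]
    push_cast
    field_simp
    ring

theorem MInvClass.apply_I {κ Q : ℝ} (hκ0 : 0 ≤ κ) (hκ1 : κ < 1) {V : ℂ → ℂ}
    (hV : MInvClass κ Q V) : V Complex.I = Q + ((1 + κ) / (1 - κ) : ℝ) * Complex.I := by
  obtain ⟨μ, -, h2, h3⟩ := hV
  have ha : 0 ≤ (1 + κ) / (1 - κ) := div_nonneg (by linarith) (by linarith)
  obtain ⟨-, h4⟩ := integrable_and_integral_eq_of_lintegral ha h2
  rw [h3 _ (by simp), ← h4, ← integral_cauchyKer_I]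
  rfl

/-- The determinant `c² + s² = 1` makes the rotation preserve the upper half-plane. -/
theorem moebius_im {c s : ℝ} (hcs : c ^ 2 + s ^ 2 = 1) {v : ℂ} :
    ((c + s * v) / (s - c * v)).im = v.im / Complex.normSq (s - c * v) := by
  rw [Complex.div_im, ← sub_div]
  congr 1
  simp
  linear_combination v.im * hcs

theorem moebius_denom_ne_zero {c s : ℝ} (hc : c ≠ 0) {v : ℂ} (hv : 0 < v.im) :
    (s : ℂ) - c * v ≠ 0 := by
  intro h
  have := congrArg Complex.im h
  simp at this
  exact this.elim hc hv.ne'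

theorem mInvClass_moebius_iff {κ Q a b c s : ℝ} (hκ0 : 0 ≤ κ) (hκ1 : κ < 1)
    (ha : a = (1 + κ) / (1 - κ)) (hb : b = Q ^ 2 + a ^ 2 - 1) (hc : c ≠ 0)
    (hcs : c ^ 2 + s ^ 2 = 1) {V V' : ℂ → ℂ} (hV : MInvClass κ Q V)
    (hV' : ∀ z : ℂ, 0 < z.im → V' z * (s - c * V z) = c + s * V z) :
    MInvClass κ (-Q) V' ↔ c * b = 2 * Q * s := by
  have ha0 : 0 < a := ha ▸ div_pos (by linarith) (by linarith)
  have hVI := MInvClass.apply_I hκ0 hκ1 hV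
  rw [← ha] at hVI
  constructor
  · intro h
    have h1 := MInvClass.apply_I hκ0 hκ1 h
    rw [← ha] at h1
    -- Only the real part carries information; the imaginary part holds identically.
    have h2 := congrArg Complex.re (hV' Complex.I (by simp))
    rw [h1, hVI] at h2
    simp at h2
    rw [hb]
    linear_combination h2
  · intro h
    obtain ⟨μ, hinf, hlin, hrep⟩ := hV
    rw [← ha] at hlin
    obtain ⟨hμ, -⟩ := integrable_and_integral_eq_of_lintegral ha0.le hlin
    have hμ0 : μ ≠ 0 := by rintro rfl; simp at hinf
    set W : ℂ → ℂ := fun z => Q + ∫ t, cauchyKer z t ∂μ with hW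
    have hVW : ∀ z : ℂ, 0 < z.im → V z = W z := hrep
    have hWpos : ∀ z : ℂ, 0 < z.im → 0 < (W z).im := fun z hz => by
      simpa [hW] using integral_cauchyKer_im_pos hμ hμ0 hz
    set F : ℂ → ℂ := fun z => (c + s * W z) / (s - c * W z) with hF
    have hden : ∀ z : ℂ, 0 < z.im → (s : ℂ) - c * W z ≠ 0 := fun z hz =>
      moebius_denom_ne_zero hc (hWpos z hz)
    have hV'F : ∀ z : ℂ, 0 < z.im → V' z = F z := fun z hz => by
      rw [hF, eq_div_iff (hden z hz), ← hVW z hz, hV' z hz]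
    have hWd : DifferentiableOn ℂ W {z : ℂ | 0 < z.im} :=
      (differentiableOn_const _).add (differentiableOn_integral_cauchyKer hμ)
    have hFd : DifferentiableOn ℂ F {z : ℂ | 0 < z.im} :=
      ((hWd.const_mul _).const_add _).div ((hWd.const_mul _).const_sub _) hden
    obtain ⟨γ, ν, hγ, hν, hνrep⟩ := exists_nevanlinna_representation hFd fun z hz => by
      rw [hF, moebius_im hcs]
      exact div_nonneg (hWpos z hz).le (Complex.normSq_nonneg _)
    have hFI : F Complex.I = -Q + a * Complex.I := by
      rw [hF]
      simp only
      rw [div_eq_iff (hden _ (by simp)), ← hVW _ (by simp), hVI]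
      have hC : (c : ℂ) * (Q ^ 2 + a ^ 2 - 1) = 2 * Q * s := by rw [hb] at h; exact_mod_cast h
      linear_combination ((c : ℂ) * a ^ 2) * Complex.I_sq - hC
    have hFre : (F Complex.I).re = -Q := by simp [hFI]
    -- Both functions have their constants split off in `(s - cW)(s + cF) = c² + s² = 1`.
    obtain ⟨hγ0, hνinf⟩ := moebius_no_linear_term_and_infinite hμ hinf hν hc (s - c * Q)
      (s + c * -Q) γ fun y hy => by
        have hz : 0 < ((y : ℂ) * Complex.I).im := by simpa using hy
        have h1 := hνrep _ hz
        have h2 := hden _ hz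
        have h3 : F (y * Complex.I) * (s - c * W (y * Complex.I)) =
          c + s * W (y * Complex.I) := div_mul_cancel₀ _ h2
        have hcsC : (c : ℂ) ^ 2 + s ^ 2 = 1 := by exact_mod_cast hcs
        rw [hFre] at h1
        simp only [hW] at h3
        push_cast at h1 ⊢
        linear_combination (c : ℂ) * h3 + hcsC - (c : ℂ) * (s - c * W (y * Complex.I)) * h1
    subst hγ0
    refine ⟨ν, hνinf, ?_, fun z hz => ?_⟩
    · rw [← ha, ← ofReal_integral_eq_lintegral_ofReal hν (.of_forall fun t => by
        simp only [Pi.zero_apply]; positivity)]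
      have h1 := congrArg Complex.im (hνrep Complex.I (by simp))
      rw [integral_cauchyKer_I, hFI] at h1
      simp at h1
      simp [h1]
    · rw [hV'F z hz, hνrep z hz, hFre]
      simp [cauchyKer]

/-! ### Surjectivity of `S - z` for self-adjoint `S`. -/

section SelfAdjoint

variable {E : Type*} [NormedAddCommGroup E] [InnerProductSpace ℂ E]

/-- Pair `y - zx` with `x`, take imaginary parts and apply Cauchy–Schwarz. -/
theorem abs_im_mul_norm_le_of_inner_im_eq_zero {z : ℂ} {x y : E} (h : (inner ℂ x y).im = 0) :
    |z.im| * ‖x‖ ≤ ‖y - z • x‖ := by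
  have h1 : (inner ℂ x (y - z • x)).im = -(z.im * ‖x‖ ^ 2) := by
    rw [inner_sub_right, inner_smul_right, Complex.sub_im, h, inner_self_eq_norm_sq_to_K,
      Complex.mul_im]
    simp [← Complex.ofReal_pow]
  have h2 : |z.im| * ‖x‖ * ‖x‖ ≤ ‖y - z • x‖ * ‖x‖ := by
    calc |z.im| * ‖x‖ * ‖x‖ = |(inner ℂ x (y - z • x)).im| := by
          rw [h1, abs_neg, abs_mul, abs_of_nonneg (sq_nonneg ‖x‖)]; ring
      _ ≤ ‖inner ℂ x (y - z • x)‖ := Complex.abs_im_le_norm _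
      _ ≤ ‖x‖ * ‖y - z • x‖ := norm_inner_le_norm _ _
      _ = _ := mul_comm _ _
  rcases (norm_nonneg x).eq_or_lt with h0 | h0
  · rw [← h0]; simp
  · exact le_of_mul_le_mul_right h2 h0

variable [CompleteSpace E]

theorem inner_im_eq_zero_of_mem_graph {S : E →ₗ.[ℂ] E} (hS : IsSelfAdjoint S) {x y : E}
    (h : (x, y) ∈ S.graph) : (inner ℂ x y).im = 0 := by
  obtain ⟨f, rfl, rfl⟩ := S.mem_graph_iff.mp h
  have h1 : S.IsFormalAdjoint S := by
    have := LinearPMap.adjoint_isFormalAdjoint hS.dense_domain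
    rwa [LinearPMap.isSelfAdjoint_def.mp hS] at this
  have h2 := h1 f f
  rw [← Complex.conj_eq_iff_im, inner_conj_symm]
  exact h2

/-- The range of `S - z I` is everything for self-adjoint `S` and non-real `z`. -/
theorem exists_mem_graph_sub_smul_eq {S : E →ₗ.[ℂ] E} (hS : IsSelfAdjoint S) {z : ℂ}
    (hz : z.im ≠ 0) (h : E) : ∃ x y : E, (x, y) ∈ S.graph ∧ y - z • x = h := by
  have : CompleteSpace S.graph := hS.isClosed.completeSpace_coe
  set L : S.graph →L[ℂ] E :=
    ((ContinuousLinearMap.snd ℂ E E) - z • ContinuousLinearMap.fst ℂ E E).comp S.graph.subtypeL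
    with hL
  have hLapp : ∀ p : S.graph, L p = p.1.2 - z • p.1.1 := fun p => rfl
  have hzpos : 0 < |z.im| := abs_pos.mpr hz
  set C : NNReal := ⟨|z.im|⁻¹ + (1 + ‖z‖ * |z.im|⁻¹), by positivity⟩ with hC
  -- Bounded below on the complete graph, `L` has closed range.
  have hanti : AntilipschitzWith C L := by
    refine AddMonoidHomClass.antilipschitz_of_bound L fun p => ?_
    obtain ⟨⟨x, y⟩, hp⟩ := p
    have h1 := abs_im_mul_norm_le_of_inner_im_eq_zero (z := z) (inner_im_eq_zero_of_mem_graph hS hp)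
    rw [hLapp]
    change ‖((x, y) : E × E)‖ ≤ (|z.im|⁻¹ + (1 + ‖z‖ * |z.im|⁻¹)) * ‖y - z • x‖
    have h2 : ‖x‖ ≤ |z.im|⁻¹ * ‖y - z • x‖ := by
      rw [inv_mul_eq_div, le_div_iff₀ hzpos, mul_comm]; exact h1
    have h3 : ‖y‖ ≤ (1 + ‖z‖ * |z.im|⁻¹) * ‖y - z • x‖ := by
      calc ‖y‖ = ‖(y - z • x) + z • x‖ := by simp
        _ ≤ ‖y - z • x‖ + ‖z‖ * ‖x‖ := (norm_add_le _ _).trans (by rw [norm_smul])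
        _ ≤ ‖y - z • x‖ + ‖z‖ * (|z.im|⁻¹ * ‖y - z • x‖) := by gcongr
        _ = _ := by ring
    rw [Prod.norm_def, add_mul]
    refine max_le (h2.trans ?_) (h3.trans ?_)
    · exact le_add_of_nonneg_right (by positivity)
    · exact le_add_of_nonneg_left (by positivity)
  have hcl : IsClosed (Set.range L) := hanti.isClosed_range L.uniformContinuous
  set R : Submodule ℂ E := LinearMap.range (L : S.graph →ₗ[ℂ] E) with hR
  have hRcl : IsClosed (R : Set E) := hcl
  have : CompleteSpace R := hRcl.completeSpace_coe
  -- A vector orthogonal to the range is an eigenvector of `S* = S` for the non-real number `conj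
  -- z`.
  have hbot : Rᗮ = ⊥ := by
    rw [Submodule.eq_bot_iff]
    intro k hk
    have h1 : ∀ f : S.domain, inner ℂ ((conj z) • k) (f : E) = inner ℂ k (S f) := by
      intro f
      have h2 : inner ℂ (L ⟨(f, S f), S.mem_graph f⟩) k = 0 :=
        (Submodule.mem_orthogonal R k).mp hk _ ⟨_, rfl⟩
      rw [hLapp] at h2
      have h3 := congrArg conj h2
      rw [inner_conj_symm, inner_sub_right, inner_smul_right, map_zero, sub_eq_zero] at h3
      rw [inner_smul_left, Complex.conj_conj, ← h3]
    have h2 : k ∈ S.adjoint.domain := LinearPMap.mem_adjoint_domain_of_exists k ⟨_, h1⟩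
    have h3 := LinearPMap.adjoint_apply_eq hS.dense_domain ⟨k, h2⟩ h1
    have h4 : (k, conj z • k) ∈ S.graph := by
      rw [← LinearPMap.isSelfAdjoint_def.mp hS, ← h3]
      exact S.adjoint.mem_graph ⟨k, h2⟩
    have h5 := abs_im_mul_norm_le_of_inner_im_eq_zero (z := conj z)
      (inner_im_eq_zero_of_mem_graph hS h4)
    simp only [sub_self, norm_zero, Complex.conj_im, abs_neg] at h5
    exact norm_le_zero_iff.mp (by nlinarith [norm_nonneg k])
  have htop : R = ⊤ := Submodule.orthogonal_eq_bot_iff.mp hbot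
  obtain ⟨p, hp⟩ : h ∈ R := htop ▸ Submodule.mem_top
  exact ⟨p.1.1, p.1.2, p.2, hp⟩

end SelfAdjoint

/-! ### Self-adjoint bi-extensions in the rigged space. -/

variable {H : Type*} [NormedAddCommGroup H] [InnerProductSpace ℂ H] [CompleteSpace H]
variable {A : H →ₗ.[ℂ] H}

theorem incl_injective : Function.Injective (incl A) := Subtype.val_injective

theorem IsClosedSymmetric.dense_adjoint (hA : IsClosedSymmetric A) :
    Dense (A.adjoint.domain : Set H) := hA.dense.mono hA.symmetric.1

theorem toMinus_injective (hA : IsClosedSymmetric A) : Function.Injective (toMinus A) := by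
  rw [injective_iff_map_eq_zero]
  intro h hh
  refine hA.dense_adjoint.eq_zero_of_inner_right ℂ fun v hv => ?_
  have := DFunLike.congr_fun hh (⟨v, hv⟩ : A.adjoint.domain)
  exact this

theorem mem_graph_quasiKernel (hA : IsClosedSymmetric A) {B : Hplus A →L[ℂ] Hminus A} {x y : H} :
    (x, y) ∈ (quasiKernel B).graph ↔ ∃ f : Hplus A, incl A f = x ∧ B f = toMinus A y := by
  rw [quasiKernel, Submodule.toLinearPMap_graph_eq]
  · rfl
  · rintro ⟨x, y⟩ ⟨f, hf, hf'⟩ hx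
    simp only at hx hf hf'
    have : f = 0 := incl_injective (by rw [hf, hx, map_zero])
    rw [this, map_zero] at hf'
    exact (toMinus_injective hA) (by rw [← hf', map_zero])

/-- The operator `𝔹 - z I` from `H₊` to `H₋`. -/
def shift (B : Hplus A →L[ℂ] Hminus A) (z : ℂ) : Hplus A →ₗ[ℂ] Hminus A :=
  (B : Hplus A →ₗ[ℂ] Hminus A) - z • (toMinus A ∘ₗ incl A)

theorem shift_apply (B : Hplus A →L[ℂ] Hminus A) (z : ℂ) (f : Hplus A) :
    shift B z f = B f - z • toMinus A (incl A f) := rfl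

theorem shift_apply_apply (B : Hplus A →L[ℂ] Hminus A) (z : ℂ) (f g : Hplus A) :
    shift B z f g = B f g - z * inner ℂ (incl A g) (incl A f) := rfl

theorem biResolvent_eq {B : Hplus A →L[ℂ] Hminus A} {z : ℂ} (hB : Function.Injective (shift B z))
    {x : Hplus A} {φ : Hminus A} (hx : shift B z x = φ) : biResolvent B z φ = x := by
  rw [← hx]
  exact Function.leftInverse_invFun hB x

section SelfAdjointBiExt

variable {B : Hplus A →L[ℂ] Hminus A}

theorem conj_apply_of_biAdj_eq (hB : biAdj B = B) (f g : Hplus A) : conj (B f g) = B g f := by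
  rw [← biAdj_apply, hB]

theorem shift_injective_of_im_ne_zero (hB : biAdj B = B) {z : ℂ} (hz : z.im ≠ 0) :
    Function.Injective (shift B z) := by
  rw [injective_iff_map_eq_zero]
  intro f hf
  have h1 := congrArg Complex.im (DFunLike.congr_fun hf f)
  have h2 : (B f f).im = 0 := Complex.conj_eq_iff_im.mp (conj_apply_of_biAdj_eq hB f f)
  rw [shift_apply_apply, Complex.sub_im, h2, inner_self_eq_norm_sq_to_K] at h1
  have h3 : z.im * ‖incl A f‖ ^ 2 = 0 := by
    simpa [Complex.mul_im, ← Complex.ofReal_pow] using h1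
  have h4 : incl A f = 0 := by simpa [hz] using h3
  exact incl_injective (by rw [h4, map_zero])

/-- Self-adjointness of the quasi-kernel only reaches right-hand sides in `H`; reaching `K 1` takes
a further argument. -/
theorem exists_shift_eq_toMinus (hA : IsClosedSymmetric A) (hB : IsTSelfAdjointBiExt B) {z : ℂ}
    (hz : z.im ≠ 0) (h : H) : ∃ u : Hplus A, shift B z u = toMinus A h := by
  obtain ⟨x, y, hxy, rfl⟩ := exists_mem_graph_sub_smul_eq hB.quasiKernel_self_adjoint hz h
  obtain ⟨f, rfl, hf⟩ := (mem_graph_quasiKernel hA).mp hxy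
  exact ⟨f, by rw [shift_apply, hf, map_sub, map_smul]⟩

end SelfAdjointBiExt

theorem eq_biRe_add_biIm (B : Hplus A →L[ℂ] Hminus A) (f : Hplus A) :
    B f = biRe B f + Complex.I • biIm B f := by
  ext g
  simp [biRe, biIm]
  field_simp
  linear_combination (B f g - biAdj B f g) * Complex.I_sq

/-! ### Impedance, transfer function and resolvent set of an L-system. -/

namespace LSystem

variable (Θ : LSystem H)

theorem K_apply (w : ℂ) : Θ.K w = w • Θ.K 1 := by
  rw [← map_smul, smul_eq_mul, mul_one]

theorem channelAdj_apply (f : Hplus Θ.A) : channelAdj Θ.K f = conj (Θ.K 1 f) := rfl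

theorem stateOp_apply (f : Hplus Θ.A) : Θ.stateOp f =
    biRe Θ.stateOp f + (Complex.I * channelAdj Θ.K f) • Θ.K 1 := by
  rw [eq_biRe_add_biIm Θ.stateOp f, Θ.im_eq, Θ.K_apply, smul_smul]

theorem shift_stateOp (z : ℂ) (f : Hplus Θ.A) : shift Θ.stateOp z f =
    shift (biRe Θ.stateOp) z f + (Complex.I * channelAdj Θ.K f) • Θ.K 1 := by
  rw [shift_apply, shift_apply, stateOp_apply]
  abel

theorem biAdj_biRe : biAdj (biRe Θ.stateOp) = biRe Θ.stateOp :=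
  Θ.starExt.re_tSelfAdjoint.self_adjoint

theorem shift_biRe_injective {z : ℂ} (hz : z.im ≠ 0) :
    Function.Injective (shift (biRe Θ.stateOp) z) :=
  shift_injective_of_im_ne_zero Θ.biAdj_biRe hz

/-- If `K*` vanished wherever `𝔸 f ∈ H`, then `𝔸` would agree there with `Re 𝔸`, making `T`
symmetric. -/
theorem exists_channelAdj_ne_zero : ∃ (f : Hplus Θ.A) (h : H),
    Θ.stateOp f = toMinus Θ.A h ∧ channelAdj Θ.K f ≠ 0 := by
  by_contra! hcon
  refine Θ.classLambda.not_symmetric fun f g => ?_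
  obtain ⟨f', hf, hf'⟩ := Θ.starExt.extends_op f
  obtain ⟨g', hg, hg'⟩ := Θ.starExt.extends_op g
  have key : ∀ u v : Hplus Θ.A, ∀ k : H, Θ.stateOp u = toMinus Θ.A k →
      inner ℂ (incl Θ.A v) k = biRe Θ.stateOp u v := by
    intro u v k hu
    rw [← toMinus_apply, ← hu, Θ.stateOp_apply, hcon u k hu]
    simp
  rw [← hf, ← hg, ← inner_conj_symm, key f' g' _ hf', key g' f' _ hg',
    conj_apply_of_biAdj_eq Θ.biAdj_biRe]

/-- For `f` as in `exists_channelAdj_ne_zero`, `(Re 𝔸 - z) f` differs from a vector of `H` by a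
non-zero multiple of `K 1`, and vectors of `H` are in the range. -/
theorem exists_shift_biRe_eq_K {z : ℂ} (hz : z.im ≠ 0) :
    ∃ x : Hplus Θ.A, shift (biRe Θ.stateOp) z x = Θ.K 1 := by
  obtain ⟨f, h, hf, hne⟩ := Θ.exists_channelAdj_ne_zero
  obtain ⟨u, hu⟩ := exists_shift_eq_toMinus Θ.closedSymmetric Θ.starExt.re_tSelfAdjoint hz
    (h - z • incl Θ.A f)
  have h1 := Θ.shift_stateOp z f
  rw [shift_apply, hf, ← map_smul, ← map_sub, ← hu] at h1
  have h2 : Complex.I * channelAdj Θ.K f ≠ 0 := mul_ne_zero Complex.I_ne_zero hne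
  refine ⟨(Complex.I * channelAdj Θ.K f)⁻¹ • (u - f), ?_⟩
  rw [map_smul, map_sub, h1, add_sub_cancel_left, smul_smul, inv_mul_cancel₀ h2, one_smul]

theorem impedance_eq {z : ℂ} (hz : z.im ≠ 0) {x : Hplus Θ.A}
    (hx : shift (biRe Θ.stateOp) z x = Θ.K 1) : Θ.impedance z = channelAdj Θ.K x := by
  rw [impedance, biResolvent_eq (Θ.shift_biRe_injective hz) hx]

theorem impedance_im {z : ℂ} (hz : z.im ≠ 0) {x : Hplus Θ.A}
    (hx : shift (biRe Θ.stateOp) z x = Θ.K 1) :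
    (Θ.impedance z).im = z.im * ‖incl Θ.A x‖ ^ 2 := by
  have h2 : (biRe Θ.stateOp x x).im = 0 :=
    Complex.conj_eq_iff_im.mp (conj_apply_of_biAdj_eq Θ.biAdj_biRe x x)
  rw [Θ.impedance_eq hz hx, channelAdj_apply, ← hx, Complex.conj_im, shift_apply_apply,
    Complex.sub_im, h2, inner_self_eq_norm_sq_to_K]
  simp [Complex.mul_im, ← Complex.ofReal_pow]

theorem impedance_conj {z : ℂ} (hz : z.im ≠ 0) : Θ.impedance (conj z) = conj (Θ.impedance z) := by
  have hz' : (conj z).im ≠ 0 := by simpa using hz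
  obtain ⟨x, hx⟩ := Θ.exists_shift_biRe_eq_K hz
  obtain ⟨y, hy⟩ := Θ.exists_shift_biRe_eq_K hz'
  rw [Θ.impedance_eq hz hx, Θ.impedance_eq hz' hy, channelAdj_apply, channelAdj_apply,
    Complex.conj_conj]
  nth_rewrite 1 [← hx]
  rw [← hy, shift_apply_apply, shift_apply_apply, map_sub, map_mul, inner_conj_symm,
    conj_apply_of_biAdj_eq Θ.biAdj_biRe]

/-- Here `Im V ≤ 0`, so the real part `1 - Im V` is at least `1`. -/
theorem one_add_I_mul_impedance_ne_zero {z : ℂ} (hz : z.im < 0) :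
    1 + Complex.I * Θ.impedance z ≠ 0 := by
  obtain ⟨x, hx⟩ := Θ.exists_shift_biRe_eq_K hz.ne
  have h1 := Θ.impedance_im hz.ne hx
  intro h
  have h2 := congrArg Complex.re h
  simp at h2
  nlinarith [mul_nonneg (neg_nonneg.mpr hz.le) (sq_nonneg ‖incl Θ.A x‖)]

/-- The linear-fractional relation between the transfer and impedance functions. -/
theorem transfer_mul {z : ℂ} (hz : z.im ≠ 0) (hV : 1 + Complex.I * Θ.impedance z ≠ 0) :
    Θ.transfer z * (1 + Complex.I * Θ.impedance z) = 1 - Complex.I * Θ.impedance z := by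
  obtain ⟨x, hx⟩ := Θ.exists_shift_biRe_eq_K hz
  have hVx := Θ.impedance_eq hz hx
  have hinj : Function.Injective (shift Θ.stateOp z) := by
    rw [injective_iff_map_eq_zero]
    intro f hf
    set w := channelAdj Θ.K f with hw
    rw [Θ.shift_stateOp, ← hw, ← hx, ← map_smul, ← map_add] at hf
    have h1 : f + (Complex.I * w) • x = 0 :=
      Θ.shift_biRe_injective hz (by rw [hf, map_zero])
    have h2 := congrArg (channelAdj Θ.K) h1
    rw [map_add, map_smul, map_zero, ← hw, ← hVx, smul_eq_mul] at h2
    have h3 : w * (1 + Complex.I * Θ.impedance z) = 0 := by linear_combination h2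
    have h4 : w = 0 := (mul_eq_zero.mp h3).resolve_right hV
    simpa [h4] using h1
  have hsol : shift Θ.stateOp z ((1 + Complex.I * Θ.impedance z)⁻¹ • x) = Θ.K 1 := by
    rw [map_smul, Θ.shift_stateOp, hx, ← hVx]
    ext g
    simp only [smul_apply, add_apply, smul_eq_mul]
    field_simp
  rw [transfer, biResolvent_eq hinj hsol, map_smul, ← hVx, smul_eq_mul]
  field_simp
  ring

theorem dense_T : Dense (Θ.T.domain : Set H) :=
  Θ.closedSymmetric.dense.mono Θ.classLambda.le.1

theorem exists_adjoint_sub_eq {z : ℂ} (hz : z ∈ resolvent Θ.T) (k : H) :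
    ∃ g : Θ.T.adjoint.domain, Θ.T.adjoint g - conj z • (g : H) = k := by
  obtain ⟨R, -, hR⟩ := hz
  have h1 : ∀ f : Θ.T.domain,
      inner ℂ (k + conj z • R.adjoint k) (f : H) = inner ℂ (R.adjoint k) (Θ.T f) := by
    intro f
    have h2 : inner ℂ (R.adjoint k) (Θ.T f - z • (f : H)) = inner ℂ k (f : H) := by
      rw [ContinuousLinearMap.adjoint_inner_left, hR]
    rw [inner_sub_right, inner_smul_right] at h2
    rw [inner_add_left, inner_smul_left, Complex.conj_conj, ← h2]
    ring
  have h2 := LinearPMap.mem_adjoint_domain_of_exists _ ⟨_, h1⟩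
  refine ⟨⟨_, h2⟩, ?_⟩
  rw [LinearPMap.adjoint_apply_eq Θ.dense_T ⟨_, h2⟩ h1]
  simp

/-- `T* - conj z` is onto `H` and `𝔸* ⊃ T*`; pairing with a kernel vector of `𝔸 - z` annihilates it.
-/
theorem shift_stateOp_injective {z : ℂ} (hz : z ∈ resolvent Θ.T) :
    Function.Injective (shift Θ.stateOp z) := by
  rw [injective_iff_map_eq_zero]
  intro f hf
  obtain ⟨g, hg⟩ := Θ.exists_adjoint_sub_eq hz (incl Θ.A f)
  obtain ⟨g', hgg, hg'⟩ := Θ.starExt.adj_extends g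
  have h1 := DFunLike.congr_fun hf g'
  rw [shift_apply_apply] at h1
  have h2 := DFunLike.congr_fun hg' f
  rw [biAdj_apply, toMinus_apply] at h2
  have h3 := congrArg conj h1
  rw [map_sub, map_mul, h2, inner_conj_symm, hgg, ← inner_smul_right, ← inner_sub_right, hg] at h3
  have h4 : incl Θ.A f = 0 := by simpa using h3
  exact incl_injective (by rw [h4, map_zero])

/-- At a point of `ρ(T)`, the solution given by the resolvent of `T` also solves the equation for
`𝔸`, hence equals `y` by injectivity. -/
theorem mem_domain_T_of_stateOp_eq {y : Hplus Θ.A} {h : H} (hy : Θ.stateOp y = toMinus Θ.A h) :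
    ∃ hd : incl Θ.A y ∈ Θ.T.domain, Θ.T ⟨incl Θ.A y, hd⟩ = h := by
  obtain ⟨z, hz⟩ := Θ.classLambda.resolvent_nonempty
  have hinj := Θ.shift_stateOp_injective hz
  obtain ⟨R, hR, -⟩ := hz
  obtain ⟨k, hk⟩ : ∃ k, k = h - z • incl Θ.A y := ⟨_, rfl⟩
  obtain ⟨hd, hT⟩ := hR k
  obtain ⟨f, hf, hf'⟩ := Θ.starExt.extends_op ⟨_, hd⟩
  have hfy : f = y := by
    apply hinj
    rw [shift_apply, shift_apply, hy, hf', hf]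
    simp only [← map_smul (toMinus Θ.A), ← map_sub (toMinus Θ.A)]
    exact congrArg _ (hT.trans hk)
  subst hfy
  simp only at hf
  refine ⟨hf ▸ hd, ?_⟩
  have h1 : Θ.T ⟨incl Θ.A f, hf ▸ hd⟩ = Θ.T ⟨_, hd⟩ := congrArg _ (Subtype.ext hf)
  rw [h1]
  exact toMinus_injective Θ.closedSymmetric (by rw [← hf', hy])

theorem exists_shift_stateOp_eq {z : ℂ} (hz : z.im < 0) (h : H) :
    ∃ y : Hplus Θ.A, shift Θ.stateOp z y = toMinus Θ.A h := by
  obtain ⟨x, hx⟩ := Θ.exists_shift_biRe_eq_K hz.ne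
  obtain ⟨u, hu⟩ := exists_shift_eq_toMinus Θ.closedSymmetric Θ.starExt.re_tSelfAdjoint hz.ne h
  have hV := Θ.one_add_I_mul_impedance_ne_zero hz
  rw [Θ.impedance_eq hz.ne hx] at hV
  -- The coefficient of `x` is chosen to cancel the rank-one term, as in the Sherman–Morrison
  -- formula.
  refine ⟨u + (-Complex.I * channelAdj Θ.K u / (1 + Complex.I * channelAdj Θ.K x)) • x, ?_⟩
  rw [Θ.shift_stateOp, map_add, map_smul, hu, hx, map_add, map_smul]
  ext g
  simp only [smul_apply, add_apply, smul_eq_mul]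
  field_simp
  ring

/-- `T` is dissipative: the imaginary part of its form at `f` is `|K* f|² ≥ 0`. -/
theorem neg_im_mul_norm_le {z : ℂ} (f : Θ.T.domain) :
    -z.im * ‖(f : H)‖ ≤ ‖Θ.T f - z • (f : H)‖ := by
  obtain ⟨f', hf, hf'⟩ := Θ.starExt.extends_op f
  have h1 : 0 ≤ (inner ℂ (f : H) (Θ.T f)).im := by
    rw [← hf, ← toMinus_apply, ← hf', Θ.stateOp_apply]
    have h2 : (biRe Θ.stateOp f' f').im = 0 :=
      Complex.conj_eq_iff_im.mp (conj_apply_of_biAdj_eq Θ.biAdj_biRe f' f')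
    simp [h2, channelAdj_apply]
    nlinarith [sq_nonneg (Θ.K 1 f').re, sq_nonneg (Θ.K 1 f').im]
  have h2 : (inner ℂ (f : H) (Θ.T f - z • (f : H))).im =
      (inner ℂ (f : H) (Θ.T f)).im - z.im * ‖(f : H)‖ ^ 2 := by
    rw [inner_sub_right, inner_smul_right, Complex.sub_im, inner_self_eq_norm_sq_to_K (f : H),
      Complex.mul_im]
    simp [← Complex.ofReal_pow]
  have h3 : -z.im * ‖(f : H)‖ * ‖(f : H)‖ ≤ ‖Θ.T f - z • (f : H)‖ * ‖(f : H)‖ := by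
    calc -z.im * ‖(f : H)‖ * ‖(f : H)‖ ≤ (inner ℂ (f : H) (Θ.T f - z • (f : H))).im := by
          rw [h2]; nlinarith
      _ ≤ ‖inner ℂ (f : H) (Θ.T f - z • (f : H))‖ := Complex.im_le_norm _
      _ ≤ ‖(f : H)‖ * ‖Θ.T f - z • (f : H)‖ := norm_inner_le_norm _ _
      _ = _ := mul_comm _ _
  rcases (norm_nonneg (f : H)).eq_or_lt with h0 | h0
  · rw [← h0]; simp
  · exact le_of_mul_le_mul_right h3 h0

/-- The open lower half-plane belongs to the resolvent set of the main operator. -/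
theorem mem_resolvent_of_im_neg {z : ℂ} (hz : z.im < 0) : z ∈ resolvent Θ.T := by
  have hsurj : ∀ h : H, ∃ f : Θ.T.domain, Θ.T f - z • (f : H) = h := by
    intro h
    obtain ⟨y, hy⟩ := Θ.exists_shift_stateOp_eq hz h
    rw [shift_apply, sub_eq_iff_eq_add, ← map_smul, ← map_add] at hy
    obtain ⟨hd, hT⟩ := Θ.mem_domain_T_of_stateOp_eq hy
    exact ⟨⟨_, hd⟩, by rw [hT, add_sub_cancel_right]⟩
  set L : Θ.T.domain →ₗ[ℂ] H := Θ.T.toFun - z • Θ.T.domain.subtype with hL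
  have hLapp : ∀ f : Θ.T.domain, L f = Θ.T f - z • (f : H) := fun f => rfl
  have hinj : Function.Injective L := by
    rw [injective_iff_map_eq_zero]
    intro f hf
    have h1 := Θ.neg_im_mul_norm_le (z := z) f
    rw [← hLapp, hf, norm_zero] at h1
    have : ‖(f : H)‖ ≤ 0 := by nlinarith [norm_nonneg (f : H)]
    exact Subtype.ext (norm_le_zero_iff.mp this)
  set e : Θ.T.domain ≃ₗ[ℂ] H := LinearEquiv.ofBijective L ⟨hinj, hsurj⟩
  have he : ∀ h, Θ.T (e.symm h) - z • (e.symm h : H) = h := fun h => e.apply_symm_apply h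
  refine ⟨(Θ.T.domain.subtype ∘ₗ e.symm.toLinearMap).mkContinuous (-z.im)⁻¹ fun h => ?_,
    fun h => ⟨(e.symm h).2, he h⟩, fun f => ?_⟩
  · have h1 := Θ.neg_im_mul_norm_le (z := z) (e.symm h)
    rw [he] at h1
    rw [inv_mul_eq_div, le_div_iff₀ (by linarith), mul_comm]
    exact h1
  · exact congrArg Subtype.val (e.symm_apply_apply f)

end LSystem

/-- Under a unimodular transformation the impedance undergoes a rotation. -/
theorem IsUnimodularTransformation.impedance_mul {H' : Type*} [NormedAddCommGroup H']
    [InnerProductSpace ℂ H'] [CompleteSpace H'] {Θ : LSystem H} {Θ' : LSystem H'} {α : ℝ}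
    (h : IsUnimodularTransformation Θ Θ' α) {z : ℂ} (hz : 0 < z.im) :
    Θ'.impedance z * (Real.sin α - Real.cos α * Θ.impedance z) =
      Real.cos α + Real.sin α * Θ.impedance z := by
  -- The lower half-plane lies in both resolvent sets, while the upper one may meet the spectra. The
  -- relation has real coefficients, so conjugation carries it over.
  suffices hlow : ∀ w : ℂ, w.im < 0 →
      Θ'.impedance w * (Real.sin α - Real.cos α * Θ.impedance w) =
        Real.cos α + Real.sin α * Θ.impedance w by
    have h1 := congrArg conj (hlow (conj z) (by simpa using hz))
    simpa [-Complex.ofReal_sin, -Complex.ofReal_cos, Θ.impedance_conj hz.ne',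
      Θ'.impedance_conj hz.ne'] using h1
  intro w hw
  have h1 := h w ⟨Θ.mem_resolvent_of_im_neg hw, Θ'.mem_resolvent_of_im_neg hw⟩
  have hV := Θ.one_add_I_mul_impedance_ne_zero hw
  have hV' := Θ'.one_add_I_mul_impedance_ne_zero hw
  have h2 := Θ.transfer_mul hw.ne hV
  have h3 := Θ'.transfer_mul hw.ne hV'
  set V := Θ.impedance w
  set V' := Θ'.impedance w
  set c : ℂ := Complex.cos α with hc
  set s : ℂ := Complex.sin α with hs
  have hcs : s ^ 2 + c ^ 2 = 1 := Complex.sin_sq_add_cos_sq _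
  have hexp : Complex.exp (2 * Complex.I * α) = (c + s * Complex.I) ^ 2 := by
    rw [hc, hs, ← Complex.exp_mul_I, ← Complex.exp_nat_mul]
    congr 1
    push_cast
    ring
  rw [hexp] at h1
  have h4 : (1 - Complex.I * V') * (1 + Complex.I * V) =
      -(1 - Complex.I * V) * (c + s * Complex.I) ^ 2 * (1 + Complex.I * V') := by
    rw [← h3, ← h2, h1]
    ring
  have h5 : (c - s * Complex.I) * (c + s * Complex.I) = 1 := by
    linear_combination hcs - s ^ 2 * Complex.I_sq
  rw [Complex.ofReal_sin, Complex.ofReal_cos, ← hc, ← hs]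
  -- Multiplying by `e^{-iα}` balances the factor `e^{2iα}` between the two sides.
  have h6 : (c - s * Complex.I) * ((1 - Complex.I * V') * (1 + Complex.I * V)) =
      -(1 - Complex.I * V) * (c + s * Complex.I) * (1 + Complex.I * V') := by
    linear_combination (c - s * Complex.I) * h4 -
      (1 - Complex.I * V) * (1 + Complex.I * V') * (c + s * Complex.I) * h5
  linear_combination (-1 / 2 : ℂ) * h6 - (c * V * V' + s * (V - V')) * Complex.I_sq

end LSys

end

theorem theorem5p5
    {H : Type*} [NormedAddCommGroup H] [InnerProductSpace ℂ H] [CompleteSpace H]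
    {H' : Type*} [NormedAddCommGroup H'] [InnerProductSpace ℂ H'] [CompleteSpace H']
    (κ Q a b α : ℝ) (hκ0 : 0 ≤ κ) (hκ1 : κ < 1) (hQ : Q ≠ 0)
    (ha : a = (1 + κ) / (1 - κ)) (hb : b = Q ^ 2 + a ^ 2 - 1)
    (hα : α ∈ Set.Ico 0 Real.pi) (hα' : α ≠ Real.pi / 2)
    (Θ : LSys.LSystem H) (Θα : LSys.LSystem H')
    (hΘα : LSys.IsUnimodularTransformation Θ Θα α)
    (hV : LSys.MInvClass κ Q Θ.impedance) :
    LSys.MInvClass κ (-Q) Θα.impedance ↔ Real.tan α = b / (2 * Q) := by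
  have hc : Real.cos α ≠ 0 := by
    intro h
    obtain ⟨k, hk⟩ := Real.cos_eq_zero_iff.mp h
    have hpi := Real.pi_pos
    have h0 := hα.1
    have h1 := hα.2
    rw [hk] at h0 h1
    have h2 : (-1 : ℝ) < k := by nlinarith
    have h3 : (k : ℝ) < 1 := by nlinarith
    have h4 : -1 < k := by exact_mod_cast h2
    have h5 : k < 1 := by exact_mod_cast h3
    have : k = 0 := by omega
    apply hα'
    rw [hk, this]
    simp
  rw [LSys.mInvClass_moebius_iff hκ0 hκ1 ha hb hc (by linarith [Real.sin_sq_add_cos_sq α]) hV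
    fun z hz => hΘα.impedance_mul hz, Real.tan_eq_sin_div_cos, div_eq_div_iff hc (by simpa using hQ)]
  constructor <;> intro h <;> linarith
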